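/- **Model.** Let $a_t>-1$ ($t\ge 1$) be real parameters. $G_0$ is a single vertex, which is given degree $1$ by convention. For $t\ge 1$, $G_t$ arises from $G_{t-1}$ by a vertex-step: a new vertex is added and joined by one edge to an existing vertex $u$, chosen with conditional probability proportional to $d_{t-1}(u)+a_t$, where $d_{t-1}(u)$ is the degree of $u$ in $G_{t-1}$. (So $G_t$ has $v_t=t+1$ vertices, i.e. $y_t=v_t-v_{t-1}=1$ for all $t\ge 1$.) Let $x_t$ be the number of leaves (vertices of degree one) of $G_t$, and let $\Gamma_t=\sigma(x_0,\dots,x_t)$. **Setting.** Let $\alpha_1\ne\alpha_2$ be real numbers greater than $-1$. For every $T\in\mathbb N$ let $S=S_T$ and $R=R_T$ be natural numbers with $0\le S<R<T$ for all large $T$, such that $$\lim_{T\to\infty}\frac{T-R}{T}>0\qquad\text{and}\qquad \lim_{T\to\infty}\frac{R-S}{T}>0$$ (both limits exist). Consider, for each $T$, the process up to time $T$ with parameters $a_t=a_t^{(T)}>-1$ satisfying $a_t=\alpha_1$ for $S\le t<R$ and $a_t=\alpha_2$ for $R\le t\le T$; for $t<S$ the parameters are arbitrary. Let $P$ denote its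 law and $E$ the corresponding expectation. For $\alpha>-1$ and $S\le t\le T$ let $f_{S,t}(\alpha)$ be the conditional expectation of $x_t$ given $\Gamma_S$ in the model in which the parameters $a_s$ with $s\ge S$ are all replaced by $\alpha$. Define $$\hat a\in\operatorname*{arg\,min}_{\alpha>-1}\bigl(f_{S,T}(\alpha)-x_T\bigr)^2,\qquad h(t)=\bigl|E(x_t\mid\Gamma_S)-f_{S,t}(\hat a)\bigr|\quad(S\le t\le T),\qquad \hat R\in\operatorname*{arg\,max}_{t\in(S,T)}h(t),$$ where $t$ ranges over integers. **Proposition.** 1. With probability tending to one as $T\to\infty$, the minimizer $\hat a$ exists and is unique, and $\hat R=R-1$, that is, $R-1$ is the unique maximizer of $h$ on the integers of $(S,T)$. In particular $\lim_{T\to\infty}P(\hat R=R-1)=1$. 2. There is a constant $c>0$, not depending on $T$, such that with probability tending to one as $T\to\infty$ the minimizer $\hat a$ exists and is unique, and for a maximizer $\hat R$ $$h(\hat R)-h(t)\ \ge\ c\,|t-\hat R|\qquad\text{for all integers } S\le t\le T .$$ -/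

import Mathlib

open Filter Topology MeasureTheory

noncomputable section

namespace PrefAttach

/-- A realisation of the graph process `G_0, G_1, ..., G_T` in which every step is a vertex-step.
The vertices of `G_t` are `0, 1, ..., t`; the initial graph `G_0` has the single vertex `0`.
At time `i + 1` (for `0 ≤ i < T`) the new vertex `i + 1` is added together with an edge joining it to
the existing vertex `ω i`, which is one of `0, ..., i`. -/
abbrev History (T : ℕ) : Type := (i : Fin T) → Fin ((i : ℕ) + 1)

variable {T : ℕ}

/-- Degree of the vertex `u` in `G_t` (meaningful for `u ≤ t`). Every vertex starts with degree one:
the initial vertex by convention, every later vertex because of the edge it is born with. After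
that, each vertex attached to `u` at one of the times `1, ..., t` contributes one. -/
def degree (ω : History T) (t u : ℕ) : ℕ :=
  1 + (Finset.univ.filter fun i : Fin T => (i : ℕ) < t ∧ ((ω i : ℕ) = u)).card

/-- `x_t`: the number of leaves (vertices of degree one) of `G_t`. -/
def leaves (ω : History T) (t : ℕ) : ℕ :=
  ((Finset.range (t + 1)).filter fun u => degree ω t u = 1).card

/-- Conditional probability, given `G_i`, that the vertex added at time `i + 1` is attached to `u`,
where `0 ≤ u ≤ i`: it is proportional to `d(u) + a_{i+1}`. -/
def attachProb (a : ℕ → ℝ) (ω : History T) (i u : ℕ) : ℝ :=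
  ((degree ω i u : ℝ) + a (i + 1)) /
    ∑ v ∈ Finset.range (i + 1), ((degree ω i v : ℝ) + a (i + 1))

/-- Probability of a realisation: the product of the successive attachment probabilities. -/
def weight (a : ℕ → ℝ) (ω : History T) : ℝ :=
  ∏ i : Fin T, attachProb a ω i (ω i)

/-- The law of the process up to time `T` with parameters `a_1, a_2, ...`. -/
def law (T : ℕ) (a : ℕ → ℝ) : Measure (History T) :=
  ∑ ω : History T, ENNReal.ofReal (weight a ω) • Measure.dirac ω

/-- `Γ_S = σ(x_0, ..., x_S)`. -/
@[reducible]
def leafSigma (T S : ℕ) : MeasurableSpace (History T) :=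
  ⨆ s : Fin (S + 1), MeasurableSpace.comap (fun ω : History T => leaves ω s) ⊤

/-- `E(x_t ∣ Γ_S)` when the parameters of the process are `a`. -/
def condMean (a : ℕ → ℝ) (S t : ℕ) : History T → ℝ :=
  (law T a)[fun ω => (leaves ω t : ℝ) | leafSigma T S]

/-- `f_{S,t}(α)`: the conditional expectation `E(x_t ∣ Γ_S)` when the parameter is equal to the
constant `α` from time `S` on. -/
def fitted (a : ℕ → ℝ) (S t : ℕ) (α : ℝ) : History T → ℝ :=
  condMean (fun s => if s < S then a s else α) S t

/-- `α` is a value of the estimator `argmin_{a > -1} (f_{S,T}(a) - x_T)²`. -/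
def IsAHat (a : ℕ → ℝ) (S : ℕ) (ω : History T) (α : ℝ) : Prop :=
  -1 < α ∧ ∀ β : ℝ, -1 < β →
    (fitted a S T α ω - leaves ω T) ^ 2 ≤ (fitted a S T β ω - leaves ω T) ^ 2

/-- `h(t) = |E(x_t ∣ Γ_S) - f_{S,t}(α)|`, to be used with `α` the estimator. -/
def gap (a : ℕ → ℝ) (S : ℕ) (α : ℝ) (ω : History T) (t : ℕ) : ℝ :=
  |condMean a S t ω - fitted a S t α ω|

/-- `r` is a value of `argmax_{t ∈ (S,T)} h(t)`. -/
def IsRHat (h : ℕ → ℝ) (S T r : ℕ) : Prop :=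
  r ∈ Set.Ioo S T ∧ ∀ t ∈ Set.Ioo S T, h t ≤ h r

end PrefAttach

end

/-! Attaching to a leaf keeps the leaf count and any other attachment raises it by one. Each leaf is
hit with probability p_t(b) = b/(t+(t+1)b), where b = 1+a_{t+1}. So conditional means obey m_{t+1} =
1+(1-p_t)m_t started from x_S (`condMean_eq`, `fitted_eq`), and the mean square deviation grows by
at most one per step (`expect_sq_sub_le`). By Chebyshev, outside an event of probability O(1/T), x_T
is within εT of its mean and x_S is at least (S+1)/2-εT. The rest is deterministic
(`exists_fit_of_close`).

The endpoint of a fitted curve is continuous, strictly decreasing and 2T-Lipschitz in b. The fits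
with b₁ = 1+α₁ and b₂ = 1+α₂ end on opposite sides of the mean at distance of order T, so exactly
one β fits x_T, and it lies between b₁ and b₂, bounded away from both (`exists_fit_between`).

Let σ be the sign of b₂-b₁. The gap d_t = σ(m_t-f_t(β)) satisfies d_{t+1} = (1-p_t(β))d_t +
σ(p_t(β)-p_t(b))m_t, with b the current parameter. Before the change the source is positive but has
to beat the damping. It does: d_t stays below a fraction, strictly less than 1/2, of the level at
which damping would balance the source with m_t replaced by t+1, while m_t is almost at least
(t+1)/2 (`IsTwoPhase.signed_gap_le`, `IsTwoPhase.signed_gap_growth`). After the change, source and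
damping both lower d while it is nonnegative. Once d is negative, t|d_t| cannot decrease, so the
small final gap keeps |d_t| small (`IsTwoPhase.signed_gap_decay`). The peak sits at R-1 because a_t
governs the step from t-1 to t. -/

noncomputable section

namespace PrefAttach

variable {T : ℕ}

/-! ### Effect of one attachment on degrees and leaves -/

/-- The coordinates of a history that are revealed by time `n`. -/
def past (T n : ℕ) : Set (Fin T) := {i | (i : ℕ) < n}

lemma dependsOn_past_mono {β : Type*} {f : History T → β} {m n : ℕ} (hmn : m ≤ n)
    (hf : DependsOn f (past T m)) : DependsOn f (past T n) :=
  fun _ _ h => hf fun i hi => h i (lt_of_lt_of_le hi hmn)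

lemma dependsOn_degree (n u : ℕ) :
    DependsOn (fun ω : History T => degree ω n u) (past T n) := by
  intro ω ω' h
  simp only [degree]
  congr 2
  ext i
  simp only [Finset.mem_filter, Finset.mem_univ, true_and, and_congr_right_iff]
  intro hi
  rw [h i hi]

lemma dependsOn_leaves (n : ℕ) :
    DependsOn (fun ω : History T => leaves ω n) (past T n) := by
  intro ω ω' h
  simp only [leaves]
  congr 1
  ext u
  simp only [Finset.mem_filter, and_congr_right_iff]
  intro _
  have hd : degree ω n u = degree ω' n u := dependsOn_degree n u h
  rw [hd]

lemma dependsOn_attachProb (a : ℕ → ℝ) (n u : ℕ) :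
    DependsOn (fun ω : History T => attachProb a ω n u) (past T n) := by
  intro ω ω' h
  simp only [attachProb]
  have := fun v => dependsOn_degree n v h
  simp only at this
  simp only [this]

lemma update_eq_of_past {n : Fin T} (ω : History T) (u : Fin ((n : ℕ) + 1)) :
    ∀ i ∈ past T n, Function.update ω n u i = ω i := by
  intro i hi
  have : i ≠ n := by rintro rfl; exact lt_irrefl (i : ℕ) hi
  simp [this]

/-- Resampling the coordinate `n`. -/
lemma sum_update (n : Fin T) (F : History T → ℝ) :
    ∑ ω : History T, ∑ u : Fin ((n : ℕ) + 1), F (Function.update ω n u)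
      = ((n : ℕ) + 1 : ℝ) * ∑ ω : History T, F ω := by
  have key : ∑ q : History T × Fin ((n : ℕ) + 1), F (Function.update q.1 n q.2)
      = ∑ q : History T × Fin ((n : ℕ) + 1), F q.1 := by
    -- Exchanging the coordinate at n with the extra value is an involution on pairs.
    refine Finset.sum_nbij' (fun q => (Function.update q.1 n q.2, q.1 n))
      (fun q => (Function.update q.1 n q.2, q.1 n)) ?_ ?_ ?_ ?_ ?_ <;> simp
  rw [Fintype.sum_prod_type, Fintype.sum_prod_type] at key
  rw [key, Finset.mul_sum]
  simp

lemma degree_pos (ω : History T) (n u : ℕ) : 1 ≤ degree ω n u := by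
  simp [degree]

/-- Each of the first n attachments lies in the fibre of exactly one vertex; the other n+1 units are
the initial degrees. -/
lemma sum_degree (ω : History T) {n : ℕ} (hn : n ≤ T) :
    ∑ v ∈ Finset.range (n + 1), degree ω n v = 2 * n + 1 := by
  simp only [degree, Finset.sum_add_distrib]
  have h := Finset.card_eq_sum_card_fiberwise (f := fun i : Fin T => (ω i : ℕ))
    (s := Finset.univ.filter fun i : Fin T => (i : ℕ) < n) (t := Finset.range (n + 1)) (by
      intro i hi
      have h1 := (ω i).2
      simp at hi ⊢
      omega)
  simp only [Finset.filter_filter] at h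
  rw [← h]
  have : (Finset.univ.filter fun i : Fin T => (i : ℕ) < n).card = n := by
    rw [Fin.card_filter_val_lt]; simp [hn]
  rw [this]
  simp
  ring

/-- The conditional probability per leaf that the vertex added at time `n + 1` attaches to it,
when the parameter is `b - 1`. -/
def leafRate (n : ℕ) (b : ℝ) : ℝ := b / (n + (n + 1) * b)

lemma sum_degree_add (ω : History T) {n : ℕ} (hn : n ≤ T) (α : ℝ) :
    ∑ v ∈ Finset.range (n + 1), ((degree ω n v : ℝ) + α) = n + (n + 1) * (1 + α) := by
  rw [Finset.sum_add_distrib, ← Nat.cast_sum, sum_degree ω hn]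
  simp
  ring

lemma leafRate_denom_pos (n : ℕ) {b : ℝ} (hb : 0 < b) : 0 < (n : ℝ) + (n + 1) * b := by
  positivity

lemma attachProb_pos {a : ℕ → ℝ} (ha : ∀ t, -1 < a t) (ω : History T) {n : ℕ} (hn : n ≤ T)
    (u : ℕ) : 0 < attachProb a ω n u := by
  unfold attachProb
  rw [sum_degree_add ω hn]
  have h1 : (1 : ℝ) ≤ degree ω n u := by exact_mod_cast degree_pos ω n u
  exact div_pos (by linarith [ha (n + 1)])
    (leafRate_denom_pos n (by linarith [ha (n + 1)]))

lemma sum_attachProb {a : ℕ → ℝ} (ha : ∀ t, -1 < a t) (ω : History T) {n : ℕ} (hn : n ≤ T) :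
    ∑ u : Fin (n + 1), attachProb a ω n u = 1 := by
  unfold attachProb
  rw [← Finset.sum_div, Fin.sum_univ_eq_sum_range (fun u => (degree ω n u : ℝ) + a (n + 1)),
    div_self]
  rw [sum_degree_add ω hn]
  exact (leafRate_denom_pos n (by linarith [ha (n + 1)])).ne'

lemma leaves_eq_sum (ω : History T) (n : ℕ) :
    (leaves ω n : ℝ) = ∑ u ∈ Finset.range (n + 1), if degree ω n u = 1 then (1 : ℝ) else 0 := by
  simp [leaves]

lemma sum_attachProb_leaf (a : ℕ → ℝ) (ω : History T) {n : ℕ} (hn : n ≤ T) :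
    ∑ u : Fin (n + 1), attachProb a ω n u * (if degree ω n u = 1 then (1 : ℝ) else 0)
      = leafRate n (1 + a (n + 1)) * leaves ω n := by
  rw [Fin.sum_univ_eq_sum_range
    (fun u => attachProb a ω n u * (if degree ω n u = 1 then (1 : ℝ) else 0)), leaves_eq_sum,
    Finset.mul_sum]
  refine Finset.sum_congr rfl fun u _ => ?_
  unfold attachProb leafRate
  rw [sum_degree_add ω hn]
  split_ifs with h <;> simp [h]

lemma degree_update {n : Fin T} (ω : History T) (u : Fin ((n : ℕ) + 1)) (v : ℕ) :
    degree (Function.update ω n u) (n + 1) v = degree ω n v + if (u : ℕ) = v then 1 else 0 := by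
  unfold degree
  have hs : (Finset.univ.filter fun i : Fin T =>
      (i : ℕ) < n + 1 ∧ ((Function.update ω n u i : ℕ) = v))
      = (Finset.univ.filter fun i : Fin T => (i : ℕ) < n ∧ ((ω i : ℕ) = v)) ∪
        (if (u : ℕ) = v then {n} else ∅) := by
    ext i
    by_cases hi : i = n
    · subst hi
      by_cases h : (u : ℕ) = v <;> simp [h]
    · have : (i : ℕ) ≠ n := fun h => hi (Fin.ext h)
      have h2 : i ≤ n ↔ i < n := by rw [Fin.le_def, Fin.lt_def]; omega
      by_cases h : (u : ℕ) = v <;> simp [h, hi, h2]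
  rw [hs, Finset.card_union_of_disjoint]
  · split_ifs <;> simp [add_assoc]
  · split_ifs <;> simp

lemma degree_newborn (ω : History T) {n v : ℕ} (h : n ≤ v) : degree ω n v = 1 := by
  simp only [degree, Nat.add_eq_left, Finset.card_eq_zero, Finset.filter_eq_empty_iff]
  rintro i - ⟨hi, hv⟩
  have := (ω i).2
  omega

lemma leaves_update {n : Fin T} (ω : History T) (u : Fin ((n : ℕ) + 1)) :
    (leaves (Function.update ω n u) (n + 1) : ℝ)
      = leaves ω n + 1 - if degree ω n u = 1 then (1 : ℝ) else 0 := by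
  rw [leaves_eq_sum, Finset.sum_range_succ, leaves_eq_sum]
  have hnew : (if degree (Function.update ω n u) (n + 1) (n + 1) = 1 then (1 : ℝ) else 0) = 1 := by
    rw [degree_newborn _ le_rfl]; simp
  rw [hnew]
  have hu : (u : ℕ) ∈ Finset.range ((n : ℕ) + 1) := Finset.mem_range.2 u.2
  rw [← Finset.sum_erase_add _ _ hu, ← Finset.sum_erase_add (Finset.range ((n : ℕ) + 1)) _ hu]
  have h1 : (if degree (Function.update ω n u) (n + 1) u = 1 then (1 : ℝ) else 0) = 0 := by
    rw [degree_update]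
    have := degree_pos ω n u
    simp; omega
  rw [h1]
  have h2 : ∀ v ∈ (Finset.range ((n : ℕ) + 1)).erase u,
      (if degree (Function.update ω n u) (n + 1) v = 1 then (1 : ℝ) else 0)
        = if degree ω n v = 1 then (1 : ℝ) else 0 := by
    intro v hv
    have : (u : ℕ) ≠ v := (Finset.ne_of_mem_erase hv).symm
    rw [degree_update]
    simp [this]
  rw [Finset.sum_congr rfl h2]
  ring

lemma leaves_zero (ω : History T) : leaves ω 0 = 1 := by
  simp [leaves, degree]

lemma leaves_le (ω : History T) (n : ℕ) : leaves ω n ≤ n + 1 := by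
  simpa [leaves] using Finset.card_filter_le (Finset.range (n + 1)) fun u => degree ω n u = 1

/-! ### Total mass and the tower property -/

/-- The probability of the first `n` attachments of a realisation. -/
def partialWeight (a : ℕ → ℝ) (n : ℕ) (ω : History T) : ℝ :=
  ∏ i ∈ Finset.univ.filter (fun i : Fin T => (i : ℕ) < n), attachProb a ω i (ω i)

lemma partialWeight_top (a : ℕ → ℝ) (ω : History T) : partialWeight a T ω = weight a ω := by
  simp [partialWeight, weight]

lemma partialWeight_update (a : ℕ → ℝ) (n : Fin T) (ω : History T) (u : Fin ((n : ℕ) + 1)) :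
    partialWeight a (n + 1) (Function.update ω n u)
      = partialWeight a n ω * attachProb a ω n u := by
  unfold partialWeight
  have hs : (Finset.univ.filter fun i : Fin T => (i : ℕ) < n + 1)
      = insert n (Finset.univ.filter fun i : Fin T => (i : ℕ) < n) := by
    ext i
    simp [Fin.ext_iff]
    omega
  rw [hs, Finset.prod_insert (by simp), mul_comm]
  congr 1
  · refine Finset.prod_congr rfl fun i hi => ?_
    have hi' : (i : ℕ) < n := by simpa using hi
    rw [update_eq_of_past ω u i hi']
    exact dependsOn_attachProb a i _ fun j hj =>
      update_eq_of_past ω u j (lt_trans (show (j : ℕ) < i from hj) hi')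
  · rw [Function.update_self]
    exact dependsOn_attachProb a n _ (update_eq_of_past ω u)

lemma sum_partialWeight_succ (a : ℕ → ℝ) (n : Fin T) (φ : History T → ℝ) :
    ((n : ℕ) + 1 : ℝ) * ∑ ω, partialWeight a (n + 1) ω * φ ω
      = ∑ ω, partialWeight a n ω *
          ∑ u : Fin ((n : ℕ) + 1), attachProb a ω n u * φ (Function.update ω n u) := by
  rw [← sum_update n fun ω => partialWeight a (n + 1) ω * φ ω]
  refine Finset.sum_congr rfl fun ω _ => ?_
  rw [Finset.mul_sum]
  refine Finset.sum_congr rfl fun u _ => ?_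
  rw [partialWeight_update]
  ring

/-- Later attachments have total probability one. Summing the partial weight over full histories
counts each initial segment T!/n! times, whence the factorials. -/
lemma sum_weight_eq {a : ℕ → ℝ} (ha : ∀ t, -1 < a t) {n : ℕ} (hn : n ≤ T) {φ : History T → ℝ}
    (hφ : DependsOn φ (past T n)) :
    (T.factorial : ℝ) * ∑ ω, weight a ω * φ ω
      = n.factorial * ∑ ω, partialWeight a n ω * φ ω := by
  induction hn using Nat.decreasingInduction with
  | self => simp only [partialWeight_top]
  | of_succ k hk ih =>
    rw [ih (dependsOn_past_mono k.le_succ hφ), Nat.factorial_succ]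
    have h := sum_partialWeight_succ a ⟨k, hk⟩ φ
    have h2 : ∀ ω : History T, ∑ u : Fin (k + 1),
        attachProb a ω k u * φ (Function.update ω (⟨k, hk⟩ : Fin T) u) = φ ω := by
      intro ω
      have : ∀ u : Fin (k + 1), φ (Function.update ω (⟨k, hk⟩ : Fin T) u) = φ ω :=
        fun u => hφ (update_eq_of_past (n := ⟨k, hk⟩) ω u)
      simp only [this, ← Finset.sum_mul, sum_attachProb ha ω hk.le, one_mul]
    simp only [h2] at h
    rw [← h]
    push_cast
    ring

/-- The tower property for one attachment. -/
lemma sum_weight_step {a : ℕ → ℝ} (ha : ∀ t, -1 < a t) (n : Fin T) {φ : History T → ℝ}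
    (hφ : DependsOn φ (past T (n + 1))) :
    ∑ ω, weight a ω * φ ω
      = ∑ ω, weight a ω *
          ∑ u : Fin ((n : ℕ) + 1), attachProb a ω n u * φ (Function.update ω n u) := by
  have hT : (T.factorial : ℝ) ≠ 0 := by exact_mod_cast T.factorial_ne_zero
  refine mul_left_cancel₀ hT ?_
  rw [sum_weight_eq ha (n := n + 1) n.2 hφ, sum_weight_eq ha (n := n) n.2.le,
    ← sum_partialWeight_succ, Nat.factorial_succ]
  · push_cast; ring
  · intro ω ω' h
    refine Finset.sum_congr rfl fun u _ => ?_
    congr 1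
    · exact dependsOn_attachProb a n u h
    · refine hφ fun i hi => ?_
      by_cases hin : i = n
      · subst hin; simp
      · have : (i : ℕ) ≠ n := fun h => hin (Fin.ext h)
        have hi' : (i : ℕ) < n + 1 := hi
        simp only [Function.update_of_ne hin]
        exact h i (show (i : ℕ) < n by omega)

lemma sum_weight {a : ℕ → ℝ} (ha : ∀ t, -1 < a t) : ∑ ω : History T, weight a ω = 1 := by
  have h := sum_weight_eq (T := T) ha (Nat.zero_le T) (φ := fun _ => 1) fun _ _ _ => rfl
  have hc : Fintype.card (History T) = T.factorial := by
    rw [Fintype.card_pi]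
    simp only [Fintype.card_fin]
    rw [Fin.prod_univ_eq_prod_range (fun i => i + 1), Finset.prod_range_add_one_eq_factorial]
  have hT : (T.factorial : ℝ) ≠ 0 := by exact_mod_cast T.factorial_ne_zero
  simp only [partialWeight, hc, mul_one, Nat.not_lt_zero, Finset.filter_false,
    Finset.prod_empty, Finset.sum_const, Finset.card_univ, Nat.factorial_zero, Nat.cast_one,
    one_mul, nsmul_eq_mul] at h
  exact mul_left_cancel₀ hT (h.trans (mul_one _).symm)

lemma weight_pos {a : ℕ → ℝ} (ha : ∀ t, -1 < a t) (ω : History T) : 0 < weight a ω :=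
  Finset.prod_pos fun i _ => attachProb_pos ha ω i.2.le _

/-! ### The recursion for the mean -/

/-- The expected number of leaves at time `t`, when there are `x` leaves at time `S` and the
parameters are `b - 1`. -/
def meanLeaves (b : ℕ → ℝ) (S : ℕ) (x : ℝ) : ℕ → ℝ
  | 0 => x
  | t + 1 => if t < S then x else 1 + (1 - leafRate t (b (t + 1))) * meanLeaves b S x t

lemma meanLeaves_of_le (b : ℕ → ℝ) {S t : ℕ} (x : ℝ) (h : t ≤ S) : meanLeaves b S x t = x := by
  cases t with
  | zero => rfl
  | succ t => simp [meanLeaves, Nat.lt_of_succ_le h]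

lemma meanLeaves_succ (b : ℕ → ℝ) {S t : ℕ} (x : ℝ) (h : S ≤ t) :
    meanLeaves b S x (t + 1) = 1 + (1 - leafRate t (b (t + 1))) * meanLeaves b S x t := by
  simp [meanLeaves, not_lt.2 h]

lemma meanLeaves_congr {b b' : ℕ → ℝ} {S t : ℕ} (x : ℝ)
    (h : ∀ s, S < s → s ≤ t → b s = b' s) : meanLeaves b S x t = meanLeaves b' S x t := by
  induction t with
  | zero => rfl
  | succ t ih =>
    rcases lt_or_ge t S with ht | ht
    · rw [meanLeaves_of_le _ _ ht, meanLeaves_of_le _ _ ht]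
    · rw [meanLeaves_succ _ _ ht, meanLeaves_succ _ _ ht, h (t + 1) (by omega) le_rfl,
        ih fun s hs hst => h s hs (by omega)]

lemma leafRate_nonneg (n : ℕ) {b : ℝ} (hb : 0 < b) : 0 ≤ leafRate n b :=
  div_nonneg hb.le (leafRate_denom_pos n hb).le

lemma leafRate_le (n : ℕ) {b : ℝ} (hb : 0 < b) : leafRate n b ≤ 1 / (n + 1) := by
  unfold leafRate
  rw [div_le_div_iff₀ (leafRate_denom_pos n hb) (by positivity)]
  nlinarith [(Nat.cast_nonneg n : (0 : ℝ) ≤ n)]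

lemma leafRate_le_one (n : ℕ) {b : ℝ} (hb : 0 < b) : leafRate n b ≤ 1 :=
  (leafRate_le n hb).trans <| by
    rw [div_le_one (by positivity)]
    simp

lemma meanLeaves_nonneg {b : ℕ → ℝ} (hb : ∀ t, 0 < b t) (S : ℕ) {x : ℝ} (hx : 0 ≤ x) (t : ℕ) :
    0 ≤ meanLeaves b S x t := by
  induction t with
  | zero => exact hx
  | succ t ih =>
    rcases lt_or_ge t S with ht | ht
    · rwa [meanLeaves_of_le _ _ ht]
    · rw [meanLeaves_succ _ _ ht]
      have := mul_nonneg (sub_nonneg.2 (leafRate_le_one t (hb (t + 1)))) ih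
      linarith

lemma meanLeaves_le {b : ℕ → ℝ} (hb : ∀ t, 0 < b t) {S : ℕ} {x : ℝ} (hx : 0 ≤ x)
    (hxS : x ≤ S + 1) {t : ℕ} (ht : S ≤ t) : meanLeaves b S x t ≤ t + 1 := by
  induction t, ht using Nat.le_induction with
  | base => rwa [meanLeaves_of_le _ _ le_rfl]
  | succ t ht ih =>
    rw [meanLeaves_succ _ _ ht]
    have := mul_nonneg (leafRate_nonneg t (hb (t + 1))) (meanLeaves_nonneg hb S hx t)
    push_cast
    linarith

/-! ### First and second moments of the leaf count -/

/-- The expectation under the law of the process, as a finite sum. -/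
def expect (a : ℕ → ℝ) (φ : History T → ℝ) : ℝ := ∑ ω, weight a ω * φ ω

lemma expect_add (a : ℕ → ℝ) (φ ψ : History T → ℝ) :
    expect a (fun ω => φ ω + ψ ω) = expect a φ + expect a ψ := by
  simp [expect, mul_add, Finset.sum_add_distrib]

lemma expect_smul (a : ℕ → ℝ) (c : ℝ) (φ : History T → ℝ) :
    expect a (fun ω => c * φ ω) = c * expect a φ := by
  simp only [expect, Finset.mul_sum]
  exact Finset.sum_congr rfl fun ω _ => by ring

lemma expect_mono {a : ℕ → ℝ} (ha : ∀ t, -1 < a t) {φ ψ : History T → ℝ} (h : ∀ ω, φ ω ≤ ψ ω) :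
    expect a φ ≤ expect a ψ :=
  Finset.sum_le_sum fun ω _ => mul_le_mul_of_nonneg_left (h ω) (weight_pos ha ω).le

lemma expect_const {a : ℕ → ℝ} (ha : ∀ t, -1 < a t) (c : ℝ) :
    expect a (fun _ : History T => c) = c := by
  simp [expect, ← Finset.sum_mul, sum_weight ha]

/-- One step of the process, for the number of leaves. -/
lemma expect_step {a : ℕ → ℝ} (ha : ∀ t, -1 < a t) {n : ℕ} (hn : n < T)
    (F : History T → ℝ → ℝ) (hF : ∀ x, DependsOn (fun ω => F ω x) (past T n)) :
    expect a (fun ω => F ω (leaves ω (n + 1)))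
      = expect a fun ω =>
          leafRate n (1 + a (n + 1)) * leaves ω n * F ω (leaves ω n)
            + (1 - leafRate n (1 + a (n + 1)) * leaves ω n) * F ω (leaves ω n + 1) := by
  have hdep : DependsOn (fun ω : History T => F ω (leaves ω (n + 1))) (past T (n + 1)) := by
    intro ω ω' h
    have h1 : leaves ω (n + 1) = leaves ω' (n + 1) := dependsOn_leaves (n + 1) h
    have h2 := dependsOn_past_mono n.le_succ (hF (leaves ω' (n + 1))) h
    simp only [h1]
    exact h2
  unfold expect
  rw [sum_weight_step ha ⟨n, hn⟩ hdep]
  refine Finset.sum_congr rfl fun ω _ => ?_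
  congr 1
  have h1 : ∀ u : Fin (n + 1), attachProb a ω n u *
      F (Function.update ω (⟨n, hn⟩ : Fin T) u)
        (leaves (Function.update ω (⟨n, hn⟩ : Fin T) u) (n + 1))
      = attachProb a ω n u * (if degree ω n u = 1 then (1 : ℝ) else 0) *
          (F ω (leaves ω n) - F ω (leaves ω n + 1))
        + attachProb a ω n u * F ω (leaves ω n + 1) := by
    intro u
    have h2 := leaves_update (n := ⟨n, hn⟩) ω u
    simp only at h2
    have h3 := fun x => hF x (update_eq_of_past (n := ⟨n, hn⟩) ω u)
    simp only at h3
    rw [h2, h3]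
    split_ifs
    · rw [add_sub_cancel_right]; ring
    · rw [sub_zero]; ring
  simp only [h1]
  rw [Finset.sum_add_distrib, ← Finset.sum_mul, ← Finset.sum_mul, sum_attachProb_leaf a ω hn.le,
    sum_attachProb ha ω hn.le]
  ring

/-- The defining property of the conditional expectation, with φ as test function; the one-step mean
is affine in the leaf count, so the recursion closes. -/
lemma expect_mul_leaves {a : ℕ → ℝ} (ha : ∀ t, -1 < a t) {S : ℕ} {φ : History T → ℝ}
    (hφ : DependsOn φ (past T S)) {t : ℕ} (hSt : S ≤ t) (htT : t ≤ T) :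
    expect a (fun ω => φ ω * leaves ω t)
      = expect a fun ω => φ ω * meanLeaves (fun s => 1 + a s) S (leaves ω S) t := by
  induction t, hSt using Nat.le_induction with
  | base => simp only [meanLeaves_of_le _ _ le_rfl]
  | succ t ht ih =>
    have h := expect_step ha (n := t) htT (fun ω x => φ ω * x) (by
      intro x ω ω' h
      simp only [dependsOn_past_mono ht hφ h])
    rw [h]
    have e1 : ∀ ω : History T, leafRate t (1 + a (t + 1)) * leaves ω t * (φ ω * leaves ω t)
            + (1 - leafRate t (1 + a (t + 1)) * leaves ω t) * (φ ω * (leaves ω t + 1))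
          = φ ω + (1 - leafRate t (1 + a (t + 1))) * (φ ω * leaves ω t) := by
      intro ω; ring
    have e2 : ∀ ω : History T, φ ω * meanLeaves (fun s => 1 + a s) S (leaves ω S) (t + 1)
        = φ ω + (1 - leafRate t (1 + a (t + 1))) *
          (φ ω * meanLeaves (fun s => 1 + a s) S (leaves ω S) t) := by
      intro ω
      rw [meanLeaves_succ _ _ ht]
      ring
    simp only [e1, e2, expect_add, expect_smul, ih (by omega)]

/-- The conditional variance of the number of leaves grows at most linearly. -/
lemma expect_sq_sub_le {a : ℕ → ℝ} (ha : ∀ t, -1 < a t) (S : ℕ) {t : ℕ} (hSt : S ≤ t)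
    (htT : t ≤ T) :
    expect (T := T) a (fun ω =>
      ((leaves ω t : ℝ) - meanLeaves (fun s => 1 + a s) S (leaves ω S) t) ^ 2) ≤ t - S := by
  have hb : ∀ s, 0 < 1 + a s := fun s => by linarith [ha s]
  induction t, hSt using Nat.le_induction with
  | base => simp [meanLeaves_of_le _ _ le_rfl, expect]
  | succ t ht ih =>
    have h := expect_step ha (n := t) htT (fun ω x =>
      (x - meanLeaves (fun s => 1 + a s) S (leaves ω S) (t + 1)) ^ 2) (by
      intro x ω ω' h
      have h1 : leaves ω S = leaves ω' S :=
        dependsOn_past_mono ht (dependsOn_leaves S) h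
      simp only [h1])
    rw [h]
    refine (expect_mono ha (ψ := fun ω : History T =>
      ((leaves ω t : ℝ) - meanLeaves (fun s => 1 + a s) S (leaves ω S) t) ^ 2 + 1) ?_).trans ?_
    · intro ω
      set p := leafRate t (1 + a (t + 1)) with hp
      set m := meanLeaves (fun s => 1 + a s) S (leaves ω S) t with hm
      set x := (leaves ω t : ℝ) with hx
      change p * x * (x - meanLeaves (fun s => 1 + a s) S (leaves ω S) (t + 1)) ^ 2
        + (1 - p * x) * (x + 1 - meanLeaves (fun s => 1 + a s) S (leaves ω S) (t + 1)) ^ 2 ≤ _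
      rw [meanLeaves_succ _ _ ht, ← hp, ← hm]
      have hp0 : 0 ≤ p := leafRate_nonneg t (hb (t + 1))
      have hp1 : p * (t + 1) ≤ 1 := by
        have := leafRate_le t (hb (t + 1))
        rwa [le_div_iff₀ (by positivity)] at this
      have hx0 : 0 ≤ x := Nat.cast_nonneg _
      have hx1 : x ≤ t + 1 := by rw [hx]; exact_mod_cast leaves_le ω t
      have hm0 : 0 ≤ m := meanLeaves_nonneg hb S (Nat.cast_nonneg _) t
      have hm1 : m ≤ t + 1 := meanLeaves_le hb (Nat.cast_nonneg _)
        (by exact_mod_cast leaves_le ω S) ht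
      have h1 : p * x ≤ 1 := (mul_le_mul_of_nonneg_left hx1 hp0).trans hp1
      have h2 : p * m ≤ 1 := (mul_le_mul_of_nonneg_left hm1 hp0).trans hp1
      have h3 := mul_nonneg hp0 hx0
      have h4 := mul_nonneg hp0 hm0
      -- The cross terms combine to -2p(x-m)². The last bracket averages two numbers in [0,1], so it
      -- adds at most one.
      have e : p * x * (x - (1 + (1 - p) * m)) ^ 2 + (1 - p * x) * (x + 1 - (1 + (1 - p) * m)) ^ 2
          = (x - m) ^ 2 - 2 * p * (x - m) ^ 2 + (p * x * (1 - p * m) ^ 2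
            + (1 - p * x) * (p * m) ^ 2) := by ring
      rw [e]
      have h5 : (1 - p * m) ^ 2 ≤ 1 := by nlinarith
      have h6 : (p * m) ^ 2 ≤ 1 := by nlinarith
      nlinarith [mul_nonneg hp0 (sq_nonneg (x - m))]
    · rw [expect_add, expect_const ha]
      push_cast
      linarith [ih (by omega)]

/-! ### The law as a measure and its conditional expectations -/

lemma law_apply {a : ℕ → ℝ} (ha : ∀ t, -1 < a t) (A : Set (History T)) :
    law T a A = ENNReal.ofReal (expect a (A.indicator fun _ => 1)) := by
  classical
  unfold law expect
  rw [ENNReal.ofReal_sum_of_nonneg]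
  · simp only [Measure.coe_finsetSum, Measure.coe_smul, Finset.sum_apply, Pi.smul_apply,
      smul_eq_mul]
    refine Finset.sum_congr rfl fun ω _ => ?_
    rw [Measure.dirac_apply' _ (MeasurableSet.of_discrete)]
    by_cases h : ω ∈ A <;> simp [h]
  · intro ω _
    exact mul_nonneg (weight_pos ha ω).le (Set.indicator_nonneg (fun _ _ => zero_le_one) _)

lemma isProbabilityMeasure_law {a : ℕ → ℝ} (ha : ∀ t, -1 < a t) :
    IsProbabilityMeasure (law T a) :=
  ⟨by rw [law_apply ha, Set.indicator_univ, expect_const ha, ENNReal.ofReal_one]⟩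

lemma integral_law {a : ℕ → ℝ} (ha : ∀ t, -1 < a t) (φ : History T → ℝ) :
    ∫ ω, φ ω ∂(law T a) = expect a φ := by
  unfold law expect
  rw [integral_finsetSum_measure fun ω _ => ?_]
  · refine Finset.sum_congr rfl fun ω _ => ?_
    rw [integral_smul_measure, integral_dirac, ENNReal.toReal_ofReal (weight_pos ha ω).le,
      smul_eq_mul]
  · exact (integrable_dirac (by simp)).smul_measure ENNReal.ofReal_ne_top

/-- Every history is an atom of positive mass. Conditional expectations under different parameters
can therefore be compared pointwise, without choosing versions. -/
lemma of_ae_law {a : ℕ → ℝ} (ha : ∀ t, -1 < a t) {P : History T → Prop}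
    (h : ∀ᵐ ω ∂(law T a), P ω) (ω : History T) : P ω := by
  by_contra hω
  have h1 : law T a {ω' | ¬ P ω'} = 0 := h
  rw [law_apply ha, ENNReal.ofReal_eq_zero] at h1
  have h2 : weight a ω * ({ω' | ¬ P ω'} : Set (History T)).indicator (fun _ => (1 : ℝ)) ω
      ≤ expect a ({ω' | ¬ P ω'}.indicator fun _ => 1) :=
    Finset.single_le_sum (f := fun ω => weight a ω *
        ({ω' | ¬ P ω'} : Set (History T)).indicator (fun _ => (1 : ℝ)) ω)
      (fun ω _ => mul_nonneg (weight_pos ha ω).le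
        (Set.indicator_nonneg (fun _ _ => zero_le_one) _)) (Finset.mem_univ ω)
  rw [Set.indicator_of_mem (show ω ∈ {ω' | ¬ P ω'} from hω), mul_one] at h2
  linarith [weight_pos ha ω]

/-- The σ-algebra of the events that are decided by time `n`. -/
@[reducible]
def pastSigma (T n : ℕ) : MeasurableSpace (History T) where
  MeasurableSet' A := DependsOn (fun ω => ω ∈ A) (past T n)
  measurableSet_empty := fun _ _ _ => rfl
  measurableSet_compl A hA := fun ω ω' h => by
    have : (ω ∈ A) = (ω' ∈ A) := hA h
    simp [this]
  measurableSet_iUnion f hf := fun ω ω' h => by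
    have : ∀ i, (ω ∈ f i) = (ω' ∈ f i) := fun i => hf i h
    simp [this]

lemma leafSigma_le_pastSigma (S : ℕ) : leafSigma T S ≤ pastSigma T S := by
  refine iSup_le fun s => ?_
  rintro _ ⟨B, -, rfl⟩ ω ω' h
  have h1 : leaves ω s = leaves ω' s :=
    dependsOn_past_mono (Nat.le_of_lt_succ s.2) (dependsOn_leaves s) h
  simp [h1]

/-- The recursion's value is a function of x_S, hence measurable for Γ_S, and it has the right
integral over every event decided by time S, in particular over those of Γ_S. -/
theorem condMean_eq {a : ℕ → ℝ} (ha : ∀ t, -1 < a t) {S t : ℕ} (hSt : S ≤ t) (htT : t ≤ T)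
    (ω : History T) :
    condMean a S t ω = meanLeaves (fun s => 1 + a s) S (leaves ω S) t := by
  have hprob := isProbabilityMeasure_law (T := T) ha
  have hm : leafSigma T S ≤ MeasurableSpace.pi := fun A _ => MeasurableSet.of_discrete
  refine (of_ae_law ha (P := fun ω =>
    meanLeaves (fun s => 1 + a s) S (leaves ω S) t = condMean a S t ω) ?_ ω).symm
  refine ae_eq_condExp_of_forall_setIntegral_eq hm .of_finite
    (fun _ _ _ => Integrable.of_finite.integrableOn) ?_ ?_
  · intro A hA _
    have hA' : DependsOn (fun ω => ω ∈ A) (past T S) := leafSigma_le_pastSigma S A hA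
    rw [← integral_indicator (hm A hA), ← integral_indicator (hm A hA), integral_law ha,
      integral_law ha]
    have hφ : DependsOn (A.indicator fun _ => (1 : ℝ)) (past T S) := by
      classical
      intro ω ω' h
      have : (ω ∈ A) = (ω' ∈ A) := hA' h
      simp [Set.indicator_apply, this]
    have h := expect_mul_leaves ha hφ hSt htT
    have e : ∀ ψ : History T → ℝ, A.indicator ψ = fun ω => A.indicator (fun _ => 1) ω * ψ ω := by
      intro ψ
      ext ω
      by_cases hω : ω ∈ A <;> simp [hω]
    rw [e, e fun ω => (leaves ω t : ℝ), h]
  · have h1 : Measurable[leafSigma T S] fun ω : History T => leaves ω S := by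
      refine Measurable.iSup' (Fin.last S) ?_
      exact comap_measurable _
    have h2 : Measurable[leafSigma T S] fun ω : History T =>
        meanLeaves (fun s => 1 + a s) S (leaves ω S) t :=
      (measurable_from_top (f := fun n : ℕ => meanLeaves (fun s => 1 + a s) S n t)).comp h1
    exact h2.stronglyMeasurable.aestronglyMeasurable

theorem fitted_eq {a : ℕ → ℝ} (ha : ∀ t, -1 < a t) {S t : ℕ} (hSt : S ≤ t) (htT : t ≤ T)
    {α : ℝ} (hα : -1 < α) (ω : History T) :
    fitted a S t α ω = meanLeaves (fun _ => 1 + α) S (leaves ω S) t := by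
  unfold fitted
  rw [condMean_eq (by intro s; split_ifs; exacts [ha s, hα]) hSt htT]
  -- From time S on only parameters with index above S enter, so the replacement of a_S itself is
  -- harmless.
  refine meanLeaves_congr _ fun s hs _ => ?_
  simp [not_lt.2 hs.le]

/-- Chebyshev's inequality. -/
lemma law_lt_abs_le {a : ℕ → ℝ} (ha : ∀ t, -1 < a t) {φ : History T → ℝ} {v δ : ℝ} (hδ : 0 < δ)
    (h : expect a (fun ω => φ ω ^ 2) ≤ v) :
    law T a {ω | δ < |φ ω|} ≤ ENNReal.ofReal (v / δ ^ 2) := by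
  rw [law_apply ha]
  refine ENNReal.ofReal_le_ofReal ?_
  have h1 : ∀ ω, ({ω | δ < |φ ω|} : Set (History T)).indicator (fun _ => (1 : ℝ)) ω
      ≤ (δ ^ 2)⁻¹ * φ ω ^ 2 := by
    intro ω
    by_cases hω : δ < |φ ω|
    · rw [Set.indicator_of_mem (show ω ∈ {ω | δ < |φ ω|} from hω), inv_mul_eq_div,
        one_le_div (by positivity), ← sq_abs (φ ω)]
      exact pow_le_pow_left₀ hδ.le hω.le 2
    · rw [Set.indicator_of_notMem (show ω ∉ {ω | δ < |φ ω|} from hω)]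
      positivity
  refine (expect_mono ha h1).trans ?_
  rw [expect_smul, inv_mul_eq_div]
  gcongr

/-! ### Dependence of the mean on the parameter -/

lemma leafRate_sub (n : ℕ) {b b' : ℝ} (hb : 0 < b) (hb' : 0 < b') :
    leafRate n b - leafRate n b'
      = (b - b') * (n / ((n + (n + 1) * b) * (n + (n + 1) * b'))) := by
  have h1 := leafRate_denom_pos n hb
  have h2 := leafRate_denom_pos n hb'
  unfold leafRate
  field_simp
  ring

lemma leafRate_lt (n : ℕ) (hn : 1 ≤ n) {b b' : ℝ} (hb' : 0 < b') (h : b' < b) :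
    leafRate n b' < leafRate n b := by
  have hb := hb'.trans h
  have h1 := leafRate_denom_pos n hb
  have h2 := leafRate_denom_pos n hb'
  have hn' : (0 : ℝ) < n := by exact_mod_cast hn
  rw [← sub_pos, leafRate_sub n hb hb']
  exact mul_pos (sub_pos.2 h) (by positivity)

lemma leafRate_signed_sub_nonneg (n : ℕ) {b b' σ : ℝ} (hb : 0 < b) (hb' : 0 < b')
    (h : 0 ≤ σ * (b - b')) : 0 ≤ σ * (leafRate n b - leafRate n b') := by
  have h1 := leafRate_denom_pos n hb
  have h2 := leafRate_denom_pos n hb'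
  rw [leafRate_sub n hb hb', ← mul_assoc]
  positivity

/-- Both denominators are at most (n+1)(1+B), and n/(n+1) ≥ 1/2. This fails at n = 0, where the rate
is one for every parameter. -/
lemma le_leafRate_signed_sub (n : ℕ) (hn : 1 ≤ n) {b b' σ B : ℝ} (hb : 0 < b) (hb' : 0 < b')
    (hB : b ≤ B) (hB' : b' ≤ B) (h : 0 ≤ σ * (b - b')) :
    σ * (b - b') / (2 * (1 + B) ^ 2) ≤ σ * (leafRate n b - leafRate n b') * (n + 1) := by
  have h1 := leafRate_denom_pos n hb
  have h2 := leafRate_denom_pos n hb'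
  have hn' : (1 : ℝ) ≤ n := by exact_mod_cast hn
  have hB0 : 0 < 1 + B := by linarith
  rw [leafRate_sub n hb hb', ← mul_assoc, mul_assoc, div_eq_mul_inv]
  refine mul_le_mul_of_nonneg_left ?_ h
  rw [div_mul_eq_mul_div, inv_eq_one_div,
    div_le_div_iff₀ (by positivity) (by positivity)]
  have h3 : (n : ℝ) + (n + 1) * b ≤ (n + 1) * (1 + B) := by nlinarith
  have h4 : (n : ℝ) + (n + 1) * b' ≤ (n + 1) * (1 + B) := by nlinarith
  have h5 := mul_le_mul h3 h4 h2.le (h1.le.trans h3)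
  have h6 : ((n : ℝ) + 1) ^ 2 ≤ 2 * (n * (n + 1)) := by nlinarith
  nlinarith [mul_le_mul_of_nonneg_right h6 (sq_nonneg (1 + B))]

lemma abs_leafRate_sub_mul_le (n : ℕ) {b b' : ℝ} (hb : 0 < b) (hb' : 0 < b') :
    |leafRate n b - leafRate n b'| * (n + 1) ≤ 2 * |b - b'| := by
  have h1 := leafRate_denom_pos n hb
  have h2 := leafRate_denom_pos n hb'
  rw [leafRate_sub n hb hb', abs_mul, mul_assoc, mul_comm (2 : ℝ)]
  refine mul_le_mul_of_nonneg_left ?_ (abs_nonneg _)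
  rw [abs_of_nonneg (by positivity), div_mul_eq_mul_div, div_le_iff₀ (by positivity)]
  rcases Nat.eq_zero_or_pos n with rfl | hn
  · simp; positivity
  · have hn' : (1 : ℝ) ≤ n := by exact_mod_cast hn
    have h3 : (n : ℝ) * n ≤ (n + (n + 1) * b) * (n + (n + 1) * b') :=
      mul_le_mul (by nlinarith) (by nlinarith) (by positivity) h1.le
    nlinarith

lemma meanLeaves_sub_succ (b b' : ℕ → ℝ) {S t : ℕ} (x : ℝ) (h : S ≤ t) :
    meanLeaves b S x (t + 1) - meanLeaves b' S x (t + 1)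
      = (1 - leafRate t (b' (t + 1))) * (meanLeaves b S x t - meanLeaves b' S x t)
        + (leafRate t (b' (t + 1)) - leafRate t (b (t + 1))) * meanLeaves b S x t := by
  rw [meanLeaves_succ _ _ h, meanLeaves_succ _ _ h]
  ring

/-- Since p_t ≤ 1/(t+1), the line (t+1)/2 is a subsolution of the recursion, and an initial deficit
e is never amplified. -/
lemma le_meanLeaves {b : ℕ → ℝ} (hb : ∀ t, 0 < b t) {S : ℕ} {x e : ℝ} (hx : 0 ≤ x) (he : 0 ≤ e)
    (h : ((S : ℝ) + 1) / 2 - e ≤ x) {t : ℕ} (ht : S ≤ t) :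
    ((t : ℝ) + 1) / 2 - e ≤ meanLeaves b S x t := by
  induction t, ht using Nat.le_induction with
  | base => rwa [meanLeaves_of_le _ _ le_rfl]
  | succ t ht ih =>
    rw [meanLeaves_succ _ _ ht]
    have h0 := meanLeaves_nonneg hb S hx t
    set m := meanLeaves b S x t
    set p := leafRate t (b (t + 1))
    have hp : p ≤ 1 / (t + 1) := leafRate_le t (hb (t + 1))
    have hp0 : 0 ≤ p := leafRate_nonneg t (hb (t + 1))
    have hp1 : p ≤ 1 := leafRate_le_one t (hb (t + 1))
    have h1 : p * ((t + 1) / 2) ≤ 1 / 2 := by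
      calc p * (((t : ℝ) + 1) / 2) ≤ 1 / (t + 1) * ((t + 1) / 2) := by gcongr
        _ = 1 / 2 := by field_simp
    have h2 := mul_le_mul_of_nonneg_left ih (sub_nonneg.2 hp1)
    have h3 := mul_nonneg hp0 he
    push_cast
    nlinarith

/-- Growth of a sequence that is damped at rate at most `1 / (t + 1)` and fed by a source. -/
lemma growth_of_source {e : ℕ → ℝ} {u v : ℕ} (huv : u ≤ v) {c : ℝ} (hc : 0 ≤ c) (hu : 0 ≤ e u)
    (h : ∀ t, u ≤ t → t < v → 0 ≤ e t → ∃ p s : ℝ, p ≤ 1 / (t + 1) ∧ c ≤ s ∧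
      e (t + 1) = (1 - p) * e t + s) :
    0 ≤ e v ∧ u * e u + c * (v - u) * u ≤ v * e v := by
  induction v, huv using Nat.le_induction with
  | base => simpa using hu
  | succ v huv ih =>
    obtain ⟨h0, h1⟩ := ih fun t ht htv => h t ht (by omega)
    obtain ⟨p, s, hp, hs, he⟩ := h v huv (by omega) h0
    have hp' : p * (v + 1) ≤ 1 := by rwa [le_div_iff₀ (by positivity)] at hp
    -- From p(v+1) ≤ 1 follows (v+1)(1-p) ≥ v: weighting by time absorbs the damping.
    have h2 : v * e v + c * (v + 1) ≤ (v + 1) * e (v + 1) := by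
      rw [he]
      nlinarith [mul_le_mul_of_nonneg_right hp' h0,
        mul_le_mul_of_nonneg_right hs (by positivity : (0 : ℝ) ≤ (v : ℝ) + 1)]
    have huv' : (u : ℝ) ≤ v := by exact_mod_cast huv
    have hv : (0 : ℝ) < (v : ℝ) + 1 := by positivity
    constructor
    · have : 0 ≤ ((v : ℝ) + 1) * e (v + 1) := by
        have : 0 ≤ (v : ℝ) * e v := by positivity
        nlinarith
      exact nonneg_of_mul_nonneg_right this hv
    · push_cast
      nlinarith

/-- Two steps are needed: the first makes the mean at least one, and the second then takes place at
a time n ≥ 1, where the rate is strictly increasing in the parameter. -/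
lemma meanLeaves_const_strictAnti {S T : ℕ} (hST : S + 2 ≤ T) {x : ℝ} (hx : 0 ≤ x)
    {β β' : ℝ} (hβ : 0 < β) (h : β < β') :
    meanLeaves (fun _ => β') S x T < meanLeaves (fun _ => β) S x T := by
  have hβ' := hβ.trans h
  obtain ⟨n, rfl⟩ : ∃ n, T = n + 1 := ⟨T - 1, by omega⟩
  have hpos : ∀ t, 0 ≤ meanLeaves (fun _ => β) S x t :=
    meanLeaves_nonneg (fun _ => hβ) S hx
  have h1 := (growth_of_source (e := fun t => meanLeaves (fun _ => β) S x t
    - meanLeaves (fun _ => β') S x t) (u := S) (v := n) (by omega) le_rfl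
    (by simp [meanLeaves_of_le _ _ le_rfl]) (fun t ht _ _ =>
      ⟨_, _, leafRate_le t hβ', ?_, meanLeaves_sub_succ _ _ x ht⟩)).1
  · have h2 := meanLeaves_sub_succ (fun _ => β) (fun _ => β') x (show S ≤ n by omega)
    obtain ⟨k, rfl⟩ : ∃ k, n = k + 1 := ⟨n - 1, by omega⟩
    have h3 : 1 ≤ meanLeaves (fun _ => β) S x (k + 1) := by
      rw [meanLeaves_succ _ _ (by omega)]
      have := mul_nonneg (sub_nonneg.2 (leafRate_le_one k hβ)) (hpos k)
      linarith
    have h4 := leafRate_lt (k + 1) (by omega) hβ h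
    have h5 := mul_nonneg (sub_nonneg.2 (leafRate_le_one (k + 1) hβ')) h1
    nlinarith
  · rcases Nat.eq_zero_or_pos t with rfl | h0
    · simp [leafRate, hβ.ne', hβ'.ne']
    · exact mul_nonneg (sub_nonneg.2 (leafRate_lt t h0 hβ h).le) (hpos t)

lemma continuousOn_meanLeaves_const (S : ℕ) (x : ℝ) (t : ℕ) :
    ContinuousOn (fun β => meanLeaves (fun _ => β) S x t) (Set.Ioi 0) := by
  induction t with
  | zero => exact continuousOn_const
  | succ t ih =>
    simp only [meanLeaves]
    split_ifs
    · exact continuousOn_const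
    · refine continuousOn_const.add ((continuousOn_const.sub ?_).mul ih)
      unfold leafRate
      exact continuousOn_id.div (by fun_prop) fun β hβ => (leafRate_denom_pos t hβ).ne'

/-- Damping never enlarges the difference, and as the mean is at most t+1 each step adds at most
2|β-β'|. -/
lemma abs_meanLeaves_const_sub_le {S : ℕ} {x : ℝ} (hx : 0 ≤ x) (hxS : x ≤ S + 1)
    {β β' : ℝ} (hβ : 0 < β) (hβ' : 0 < β') {t : ℕ} (ht : S ≤ t) :
    |meanLeaves (fun _ => β) S x t - meanLeaves (fun _ => β') S x t| ≤ 2 * |β - β'| * t := by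
  induction t, ht using Nat.le_induction with
  | base => rw [meanLeaves_of_le _ _ le_rfl, meanLeaves_of_le _ _ le_rfl]; simp; positivity
  | succ t ht ih =>
    rw [meanLeaves_sub_succ _ _ _ ht]
    have h1 := leafRate_le_one t hβ'
    have h0 := leafRate_nonneg t hβ'
    have hm := meanLeaves_le (fun _ => hβ) hx hxS ht
    have hm0 := meanLeaves_nonneg (fun _ => hβ) S hx t
    have h2 := abs_leafRate_sub_mul_le t hβ' hβ
    rw [abs_sub_comm β' β] at h2
    refine (abs_add_le _ _).trans ?_
    rw [abs_mul, abs_mul, abs_of_nonneg (sub_nonneg.2 h1), abs_of_nonneg hm0]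
    have h3 := mul_le_mul_of_nonneg_left hm (abs_nonneg (leafRate t β' - leafRate t β))
    have h4 := mul_le_mul_of_nonneg_right (show 1 - leafRate t β' ≤ 1 by linarith)
      (abs_nonneg (meanLeaves (fun _ => β) S x t - meanLeaves (fun _ => β') S x t))
    push_cast
    linarith

/-! ### Separation of the two extreme fits from the mean -/

/-- The parameters (shifted by one) equal `b₁` on `(S, r]` and `b₂` on `(r, T]`. -/
structure IsTwoPhase (b : ℕ → ℝ) (S r T : ℕ) (b₁ b₂ : ℝ) : Prop where
  pos : ∀ t, 0 < b t
  lt : S < r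
  le : r ≤ T
  first : ∀ t, S < t → t ≤ r → b t = b₁
  second : ∀ t, r < t → t ≤ T → b t = b₂

section TwoPhase

variable {b : ℕ → ℝ} {S r T : ℕ} {b₁ b₂ : ℝ} {x : ℝ}

lemma IsTwoPhase.pos_left (h : IsTwoPhase b S r T b₁ b₂) : 0 < b₁ :=
  h.first r h.lt le_rfl ▸ h.pos r

/-- The source term of the difference of two means. -/
lemma source_ge {m σ β β' B : ℝ} {t : ℕ} (ht : 1 ≤ t) (hβ : 0 < β) (hβ' : 0 < β')
    (hB : β ≤ B) (hB' : β' ≤ B) (hσ : 0 ≤ σ * (β - β')) {κ : ℝ} (hκ : 0 ≤ κ)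
    (hm : κ * (t + 1) ≤ m) :
    κ * (σ * (β - β') / (2 * (1 + B) ^ 2)) ≤ σ * ((leafRate t β - leafRate t β') * m) := by
  have h1 := le_leafRate_signed_sub t ht hβ hβ' hB hB' hσ
  have h2 := leafRate_signed_sub_nonneg t hβ hβ' hσ
  have h3 := mul_le_mul_of_nonneg_left hm h2
  have h4 := mul_le_mul_of_nonneg_left h1 hκ
  nlinarith

/-- The curves agree up to r; afterwards the difference is fed by a source bounded below. -/
lemma IsTwoPhase.fit_first_sub_ge (h : IsTwoPhase b S r T b₁ b₂) (hb₂ : 0 < b₂) {B σ : ℝ}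
    (hB₁ : b₁ ≤ B) (hB₂ : b₂ ≤ B) (hσ : 0 ≤ σ * (b₂ - b₁))
    (hm : ∀ t, r ≤ t → t ≤ T → 1 / 4 * ((t : ℝ) + 1) ≤ meanLeaves b S x t) :
    1 / 4 * (σ * (b₂ - b₁) / (2 * (1 + B) ^ 2)) * (T - r) * r
      ≤ T * (σ * (meanLeaves (fun _ => b₁) S x T - meanLeaves b S x T)) := by
  have hb₁ := h.pos_left
  have h0 : meanLeaves (fun _ => b₁) S x r - meanLeaves b S x r = 0 := by
    rw [sub_eq_zero]
    exact meanLeaves_congr x fun s hs hsr => (h.first s hs hsr).symm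
  have := (growth_of_source
    (e := fun t => σ * (meanLeaves (fun _ => b₁) S x t - meanLeaves b S x t)) h.le
    (c := 1 / 4 * (σ * (b₂ - b₁) / (2 * (1 + B) ^ 2))) (by positivity)
    (by simp only [h0]; simp) (fun t ht htT _ => ⟨leafRate t b₁,
      σ * ((leafRate t b₂ - leafRate t b₁) * meanLeaves b S x t), leafRate_le t hb₁,
      source_ge (by have := h.lt; omega) hb₂ hb₁ hB₂ hB₁ hσ (by norm_num) (hm t ht htT.le), ?_⟩)).2
  · simpa only [h0, mul_zero, zero_add] using this
  · have := meanLeaves_sub_succ b (fun _ => b₁) x (h.lt.le.trans ht)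
    rw [h.second (t + 1) (by omega) (by omega)] at this
    linear_combination (-σ) * this

/-- The difference stays nonnegative up to u, grows on [u, r], and from r to T it is only damped, so
that t·e_t does not decrease. -/
lemma IsTwoPhase.sub_fit_second_ge (h : IsTwoPhase b S r T b₁ b₂) (hx : 0 ≤ x) (hb₂ : 0 < b₂)
    {B σ : ℝ} (hB₁ : b₁ ≤ B) (hB₂ : b₂ ≤ B) (hσ : 0 ≤ σ * (b₂ - b₁)) {u : ℕ} (hSu : S ≤ u)
    (hu : 1 ≤ u) (hur : u ≤ r)
    (hm : ∀ t, u ≤ t → t ≤ T → 1 / 4 * ((t : ℝ) + 1) ≤ meanLeaves b S x t) :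
    1 / 4 * (σ * (b₂ - b₁) / (2 * (1 + B) ^ 2)) * (r - u) * u
      ≤ T * (σ * (meanLeaves b S x T - meanLeaves (fun _ => b₂) S x T)) := by
  have hb₁ := h.pos_left
  set e : ℕ → ℝ := fun t => σ * (meanLeaves b S x t - meanLeaves (fun _ => b₂) S x t) with he
  have hstep : ∀ t, S ≤ t → t < r → e (t + 1) = (1 - leafRate t b₂) * e t
      + σ * ((leafRate t b₂ - leafRate t b₁) * meanLeaves b S x t) := by
    intro t ht htr
    have := meanLeaves_sub_succ b (fun _ => b₂) x ht
    rw [h.first (t + 1) (by omega) (by omega)] at this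
    simp only [he]
    linear_combination σ * this
  have h1 := (growth_of_source (e := e) hSu le_rfl
    (by simp [he, meanLeaves_of_le _ _ le_rfl]) (fun t ht htu _ => ⟨_, _, leafRate_le t hb₂, by
      rw [← mul_assoc]
      exact mul_nonneg (leafRate_signed_sub_nonneg t hb₂ hb₁ hσ)
        (meanLeaves_nonneg h.pos S hx t), hstep t ht (by omega)⟩)).1
  have h2 := growth_of_source (e := e) hur
    (c := 1 / 4 * (σ * (b₂ - b₁) / (2 * (1 + B) ^ 2))) (by positivity) h1
    (fun t ht htr _ => ⟨_, _, leafRate_le t hb₂,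
      source_ge (by omega) hb₂ hb₁ hB₂ hB₁ hσ (by norm_num) (hm t ht (htr.le.trans h.le)),
      hstep t (hSu.trans ht) htr⟩)
  have h3 := (growth_of_source (e := e) h.le le_rfl h2.1 (fun t ht htT _ =>
    ⟨leafRate t b₂, 0, leafRate_le t hb₂, le_rfl, by
      have := meanLeaves_sub_succ b (fun _ => b₂) x (h.lt.le.trans ht)
      rw [h.second (t + 1) (by omega) (by omega)] at this
      simp only [he]
      linear_combination σ * this⟩)).2
  have h4 : 0 ≤ u * e u := by positivity
  linarith [h2.2]

end TwoPhase

/-! ### Growth and decay of the gap around the change -/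

section

/-- An upper bound for twice the gap between the mean and the fitted curve before the change. -/
def gapBound (β b₁ κ : ℝ) (t : ℕ) : ℝ := κ / β * (t * (t + 1) / (t + (t + 1) * b₁))

/-- `gapBound` is the level at which damping balances the source, with the mean replaced by its
upper bound t+1. -/
lemma leafRate_mul_gapBound (t : ℕ) {β b₁ σ : ℝ} (hβ : 0 < β) (hb₁ : 0 < b₁) :
    leafRate t β * gapBound β b₁ (σ * (β - b₁)) t
      = σ * (leafRate t β - leafRate t b₁) * (t + 1) := by
  have h1 := leafRate_denom_pos t hβ
  have h2 := leafRate_denom_pos t hb₁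
  rw [leafRate_sub t hβ hb₁]
  unfold gapBound leafRate
  field_simp

lemma gapBound_succ_ge {t : ℕ} (ht : 1 ≤ t) {β b₁ κ : ℝ} (hβ : 0 < β) (hb₁ : 0 < b₁)
    (hκ : 0 ≤ κ) :
    gapBound β b₁ κ t * (1 + 1 / (t + 1)) ≤ gapBound β b₁ κ (t + 1) := by
  have h1 := leafRate_denom_pos t hb₁
  have h2 := leafRate_denom_pos (t + 1) hb₁
  have ht' : (1 : ℝ) ≤ t := by exact_mod_cast ht
  unfold gapBound
  rw [mul_assoc]
  refine mul_le_mul_of_nonneg_left ?_ (by positivity)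
  have e : (1 : ℝ) + 1 / (t + 1) = (t + 2) / (t + 1) := by field_simp; ring
  rw [e, div_mul_div_comm, div_le_div_iff₀ (by positivity) h2]
  push_cast
  have h3 : (t : ℝ) * (t + 1 + (t + 1 + 1) * b₁) ≤ (t + 1) * (t + (t + 1) * b₁) := by
    nlinarith
  calc (t : ℝ) * (t + 1) * (t + 2) * (t + 1 + (t + 1 + 1) * b₁)
      = (t + 1) * (t + 2) * (t * (t + 1 + (t + 1 + 1) * b₁)) := by ring
    _ ≤ (t + 1) * (t + 2) * ((t + 1) * (t + (t + 1) * b₁)) := by gcongr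
    _ = _ := by ring

/-- The left side decreases in t and increases in β, so t = 1 and β = B is the extreme case. -/
lemma leafRate_mul_succ_le {t : ℕ} (ht : 1 ≤ t) {β B : ℝ} (hβ : 0 < β) (hB : β ≤ B) :
    leafRate t β * (t + 1) ≤ 2 * B / (1 + 2 * B) := by
  have h1 := leafRate_denom_pos t hβ
  have ht' : (1 : ℝ) ≤ t := by exact_mod_cast ht
  have hB0 : 0 < B := hβ.trans_le hB
  unfold leafRate
  rw [div_mul_eq_mul_div, div_le_div_iff₀ h1 (by positivity)]
  nlinarith [mul_le_mul_of_nonneg_right hB (by positivity : (0 : ℝ) ≤ (t : ℝ) + 1)]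

variable {b : ℕ → ℝ} {S r T : ℕ} {b₁ b₂ : ℝ} {x : ℝ}

lemma IsTwoPhase.signed_gap_succ_first (h : IsTwoPhase b S r T b₁ b₂) (β σ : ℝ) {t : ℕ}
    (hSt : S ≤ t) (htr : t < r) :
    σ * (meanLeaves b S x (t + 1) - meanLeaves (fun _ => β) S x (t + 1))
      = (1 - leafRate t β) * (σ * (meanLeaves b S x t - meanLeaves (fun _ => β) S x t))
        + σ * ((leafRate t β - leafRate t b₁) * meanLeaves b S x t) := by
  have := meanLeaves_sub_succ b (fun _ => β) x hSt
  rw [h.first (t + 1) (by omega) (by omega)] at this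
  linear_combination σ * this

lemma IsTwoPhase.signed_gap_succ_second (h : IsTwoPhase b S r T b₁ b₂) (β σ : ℝ) {t : ℕ}
    (hrt : r ≤ t) (htT : t < T) :
    σ * (meanLeaves b S x (t + 1) - meanLeaves (fun _ => β) S x (t + 1))
      = (1 - leafRate t β) * (σ * (meanLeaves b S x t - meanLeaves (fun _ => β) S x t))
        - σ * ((leafRate t b₂ - leafRate t β) * meanLeaves b S x t) := by
  have := meanLeaves_sub_succ b (fun _ => β) x (h.lt.le.trans hrt)
  rw [h.second (t + 1) (by omega) (by omega)] at this
  linear_combination σ * this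

lemma IsTwoPhase.signed_gap_nonneg (h : IsTwoPhase b S r T b₁ b₂) (hx : 0 ≤ x) {β σ : ℝ}
    (hβ : 0 < β) (hσ : 0 ≤ σ * (β - b₁)) {t : ℕ} (hSt : S ≤ t) (htr : t ≤ r) :
    0 ≤ σ * (meanLeaves b S x t - meanLeaves (fun _ => β) S x t) := by
  induction t, hSt using Nat.le_induction with
  | base => simp [meanLeaves_of_le _ _ le_rfl]
  | succ t ht ih =>
    rw [h.signed_gap_succ_first β σ ht htr, ← mul_assoc σ]
    have := mul_nonneg (sub_nonneg.2 (leafRate_le_one t hβ)) (ih (by omega))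
    have := mul_nonneg (leafRate_signed_sub_nonneg t hβ h.pos_left hσ)
      (meanLeaves_nonneg h.pos S hx t)
    linarith

lemma IsTwoPhase.signed_gap_le (h : IsTwoPhase b S r T b₁ b₂) (hx : 0 ≤ x) (hxS : x ≤ S + 1)
    {β σ B : ℝ} (hβ : 0 < β) (hB : β ≤ B) (hσ : 0 ≤ σ * (β - b₁)) {t : ℕ} (hSt : S ≤ t)
    (ht : 1 ≤ t) (htr : t ≤ r) :
    σ * (meanLeaves b S x t - meanLeaves (fun _ => β) S x t)
      ≤ 2 * B / (1 + 4 * B) * gapBound β b₁ (σ * (β - b₁)) t := by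
  have hb₁ := h.pos_left
  have hB0 : 0 < B := hβ.trans_le hB
  have hg : ∀ t, 0 ≤ gapBound β b₁ (σ * (β - b₁)) t := fun t => by
    unfold gapBound
    have := leafRate_denom_pos t hb₁
    positivity
  have hstart : ∀ t, σ * (meanLeaves b S x t - meanLeaves (fun _ => β) S x t) = 0 →
      σ * (meanLeaves b S x t - meanLeaves (fun _ => β) S x t)
        ≤ 2 * B / (1 + 4 * B) * gapBound β b₁ (σ * (β - b₁)) t := fun t h0 => by
    rw [h0]
    exact mul_nonneg (by positivity) (hg t)
  induction t, hSt using Nat.le_induction with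
  | base => exact hstart S (by simp [meanLeaves_of_le _ _ le_rfl])
  | succ t hSt ih =>
    rcases Nat.eq_zero_or_pos t with rfl | h0
    · refine hstart _ ?_
      obtain rfl : S = 0 := by omega
      rw [h.signed_gap_succ_first β σ hSt htr]
      simp [leafRate, hβ.ne', hb₁.ne', meanLeaves_of_le _ _ le_rfl]
    · have ih := ih h0 (by omega)
      rw [h.signed_gap_succ_first β σ hSt htr]
      set d := σ * (meanLeaves b S x t - meanLeaves (fun _ => β) S x t)
      set g := gapBound β b₁ (σ * (β - b₁)) t with hgdef
      set p := leafRate t β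
      have hm := meanLeaves_le h.pos hx hxS hSt
      have h1 : σ * ((leafRate t β - leafRate t b₁) * meanLeaves b S x t) ≤ p * g := by
        rw [leafRate_mul_gapBound t hβ hb₁, ← mul_assoc]
        exact mul_le_mul_of_nonneg_left hm (leafRate_signed_sub_nonneg t hβ hb₁ hσ)
      have h2 := mul_le_mul_of_nonneg_left ih (sub_nonneg.2 (leafRate_le_one t hβ))
      have h3 := mul_le_mul_of_nonneg_left (gapBound_succ_ge h0 hβ hb₁ hσ)
        (by positivity : 0 ≤ 2 * B / (1 + 4 * B))
      -- For k = 2B/(1+4B) the ratio k/(1-k) is 2B/(1+2B), the bound on p(t+1). This choice of k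
      -- makes d ≤ k·g invariant, as g grows by a factor of at least 1+1/(t+1).
      have h4 : p * (1 - 2 * B / (1 + 4 * B)) ≤ 2 * B / (1 + 4 * B) * (1 / (t + 1)) := by
        have h5 := leafRate_mul_succ_le h0 hβ hB
        have e : 1 - 2 * B / (1 + 4 * B) = (1 + 2 * B) / (1 + 4 * B) := by
          field_simp; ring
        rw [e, mul_one_div, le_div_iff₀ (by positivity)]
        calc p * ((1 + 2 * B) / (1 + 4 * B)) * (t + 1)
            = p * (t + 1) * ((1 + 2 * B) / (1 + 4 * B)) := by ring
          _ ≤ 2 * B / (1 + 2 * B) * ((1 + 2 * B) / (1 + 4 * B)) := by gcongr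
          _ = 2 * B / (1 + 4 * B) := by field_simp
      have h6 := mul_le_mul_of_nonneg_right h4 (hg t)
      rw [← hgdef] at h3 h6
      nlinarith

/-- Before the change the gap grows at least linearly. -/
lemma IsTwoPhase.signed_gap_growth (h : IsTwoPhase b S r T b₁ b₂) (hx : 0 ≤ x)
    (hxS : x ≤ S + 1) {β σ B η : ℝ} (hβ : 0 < β) (hB : β ≤ B) (hB₁ : b₁ ≤ B) (hη : 0 ≤ η)
    (hσ : η ≤ σ * (β - b₁)) {u : ℕ} (hSu : S ≤ u) (hu : 1 ≤ u)
    (hm : ∀ t, u ≤ t → t ≤ T →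
      (1 / 2 - 1 / (4 * (1 + 4 * B))) * ((t : ℝ) + 1) ≤ meanLeaves b S x t)
    {t : ℕ} (hut : u ≤ t) (htr : t ≤ r) :
    η / (8 * (1 + B) ^ 2 * (1 + 4 * B)) * (r - t)
      ≤ σ * (meanLeaves b S x r - meanLeaves (fun _ => β) S x r)
        - σ * (meanLeaves b S x t - meanLeaves (fun _ => β) S x t) := by
  have hb₁ := h.pos_left
  have hB0 : 0 < B := hβ.trans_le hB
  have hσ0 := hη.trans hσ
  have hstep : ∀ t, u ≤ t → t < r → η / (8 * (1 + B) ^ 2 * (1 + 4 * B)) ≤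
      σ * (meanLeaves b S x (t + 1) - meanLeaves (fun _ => β) S x (t + 1))
        - σ * (meanLeaves b S x t - meanLeaves (fun _ => β) S x t) := by
    intro t hut htr
    rw [h.signed_gap_succ_first β σ (hSu.trans hut) htr]
    have h1 := mul_le_mul_of_nonneg_left
      (h.signed_gap_le hx hxS hβ hB hσ0 (hSu.trans hut) (hu.trans hut) htr.le)
      (leafRate_nonneg t hβ)
    rw [mul_left_comm _ (2 * B / _), leafRate_mul_gapBound t hβ hb₁] at h1
    have h2 := mul_le_mul_of_nonneg_left (hm t hut (htr.le.trans h.le))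
      (leafRate_signed_sub_nonneg t hβ hb₁ hσ0)
    have h3 := le_leafRate_signed_sub t (hu.trans hut) hβ hb₁ hB hB₁ hσ0
    have h4 : η / (2 * (1 + B) ^ 2) ≤ σ * (β - b₁) / (2 * (1 + B) ^ 2) := by gcongr
    -- Put δ = 1/(4(1+4B)). In units of σ(p_t(β)-p_t(b₁))(t+1), damping costs at most 1/2-2δ and the
    -- source gives at least 1/2-δ.
    have e : 2 * B / (1 + 4 * B) = 1 / 2 - 2 * (1 / (4 * (1 + 4 * B))) := by
      field_simp; ring
    have e2 : η / (8 * (1 + B) ^ 2 * (1 + 4 * B))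
        = η / (2 * (1 + B) ^ 2) * (1 / (4 * (1 + 4 * B))) := by
      field_simp; ring
    rw [e] at h1
    rw [e2]
    have h5 := mul_le_mul_of_nonneg_right (h4.trans h3)
      (by positivity : 0 ≤ 1 / (4 * (1 + 4 * B)))
    linarith
  induction htr using Nat.decreasingInduction with
  | self => simp
  | of_succ k hk ih =>
    have h1 := hstep k hut hk
    have h2 := ih (by omega)
    push_cast at h2
    linarith

/-- After the change the gap decays linearly until it vanishes, and its possible negative values
are controlled by the final one. -/
lemma IsTwoPhase.signed_gap_decay (h : IsTwoPhase b S r T b₁ b₂) (hx : 0 ≤ x) (hb₂ : 0 < b₂)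
    {β σ B η : ℝ} (hβ : 0 < β) (hB : β ≤ B) (hB₂ : b₂ ≤ B) (hη : 0 ≤ η)
    (hσ : η ≤ σ * (b₂ - β))
    (hm : ∀ t, r ≤ t → t ≤ T → 1 / 4 * ((t : ℝ) + 1) ≤ meanLeaves b S x t)
    {t : ℕ} (hrt : r ≤ t) (htT : t ≤ T) :
    (0 ≤ σ * (meanLeaves b S x t - meanLeaves (fun _ => β) S x t) ∧
      η / (8 * (1 + B) ^ 2) * (t - r)
        ≤ σ * (meanLeaves b S x r - meanLeaves (fun _ => β) S x r)
          - σ * (meanLeaves b S x t - meanLeaves (fun _ => β) S x t)) ∨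
    (σ * (meanLeaves b S x t - meanLeaves (fun _ => β) S x t) < 0 ∧
      T * (σ * (meanLeaves b S x T - meanLeaves (fun _ => β) S x T))
        ≤ t * (σ * (meanLeaves b S x t - meanLeaves (fun _ => β) S x t))) := by
  have hσ0 := hη.trans hσ
  set d : ℕ → ℝ := fun t => σ * (meanLeaves b S x t - meanLeaves (fun _ => β) S x t) with hd
  change (0 ≤ d t ∧ _ ≤ d r - d t) ∨ (d t < 0 ∧ T * d T ≤ t * d t)
  have hstep : ∀ t, r ≤ t → t < T → ∃ s, η / (8 * (1 + B) ^ 2) ≤ s ∧ 0 ≤ s ∧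
      d (t + 1) = (1 - leafRate t β) * d t - s := by
    intro t ht htT
    refine ⟨_, ?_, ?_, h.signed_gap_succ_second β σ ht htT⟩
    · refine le_trans ?_ (source_ge (by have := h.lt; omega) hb₂ hβ hB₂ hB hσ0
        (by norm_num : (0 : ℝ) ≤ 1 / 4) (hm t ht htT.le))
      have : η / (2 * (1 + B) ^ 2) ≤ σ * (b₂ - β) / (2 * (1 + B) ^ 2) := by gcongr
      have e : η / (8 * (1 + B) ^ 2) = 1 / 4 * (η / (2 * (1 + B) ^ 2)) := by
        rw [← mul_div_mul_left η (2 * (1 + B) ^ 2) four_ne_zero]; ring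
      rw [e]
      gcongr
    · rw [← mul_assoc]
      exact mul_nonneg (leafRate_signed_sub_nonneg t hb₂ hβ hσ0)
        (meanLeaves_nonneg h.pos S hx t)
  rcases lt_or_ge (d t) 0 with hneg | hpos
  · refine Or.inr ⟨hneg, ?_⟩
    have := (growth_of_source (e := fun s => - d s) htT le_rfl (by simpa using hneg.le)
      fun s hs hsT _ => by
        obtain ⟨q, -, hq, e⟩ := hstep s (hrt.trans hs) hsT
        exact ⟨_, q, leafRate_le s hβ, hq, by linarith⟩).2
    linarith
  · refine Or.inl ⟨hpos, ?_⟩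
    induction t, hrt using Nat.le_induction with
    | base => simp
    | succ t hrt ih =>
      obtain ⟨q, hq, hq0, e⟩ := hstep t hrt htT
      have h1 : 0 ≤ (1 - leafRate t β) * d t := by linarith
      have h2 := leafRate_nonneg t hβ
      -- A negative gap stays negative, because t ≥ 1 makes the damping factor positive.
      have h3 : 0 ≤ d t := by
        by_contra hlt
        push Not at hlt
        have h4 := mul_nonneg (sub_nonneg.2 (leafRate_le_one t hβ)) (neg_nonneg.2 hlt.le)
        have h5 : leafRate t β * (t + 1) ≤ 1 := by
          have := leafRate_le t hβ
          rwa [le_div_iff₀ (by positivity)] at this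
        have ht : (1 : ℝ) ≤ t := by
          have := h.lt
          exact_mod_cast (show 1 ≤ t by omega)
        have h6 : 0 < 1 - leafRate t β := by nlinarith
        nlinarith
      have h7 := ih (by omega) h3
      push_cast
      nlinarith [mul_nonneg h2 h3]

end

/-! ### The fitted parameter and the sharp maximum -/

/-- A final value strictly between the fits with parameters `b₁` and `b₂` is fitted by a unique
parameter, which stays away from `b₁` and `b₂`. -/
lemma exists_fit_between {S T : ℕ} (hST : S + 2 ≤ T) {x y b₁ b₂ σ B γ : ℝ} (hx : 0 ≤ x)
    (hxS : x ≤ S + 1) (hb₁ : 0 < b₁) (hb₂ : 0 < b₂) (hB₁ : b₁ ≤ B) (hB₂ : b₂ ≤ B)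
    (hσ1 : σ = 1 ∨ σ = -1) (hγ : 0 < γ)
    (hy1 : γ * T ≤ σ * (meanLeaves (fun _ => b₁) S x T - y))
    (hy2 : γ * T ≤ σ * (y - meanLeaves (fun _ => b₂) S x T)) :
    ∃ β : ℝ, 0 < β ∧ β ≤ B ∧ γ / 2 ≤ σ * (β - b₁) ∧ γ / 2 ≤ σ * (b₂ - β) ∧
      meanLeaves (fun _ => β) S x T = y ∧
      ∀ β' : ℝ, 0 < β' → meanLeaves (fun _ => β') S x T = y → β' = β := by
  have hT0 : (0 : ℝ) < T := by exact_mod_cast (show 0 < T by omega)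
  have hγT : 0 < γ * T := by positivity
  have hanti := fun {β β' : ℝ} => meanLeaves_const_strictAnti hST hx (β := β) (β' := β')
  have hlip := fun {β β' : ℝ} (hβ : 0 < β) (hβ' : 0 < β') =>
    abs_meanLeaves_const_sub_le hx hxS hβ hβ' (show S ≤ T by omega)
  have hcont := continuousOn_meanLeaves_const S x T
  generalize hf : (fun β => meanLeaves (fun _ => β) S x T) = f at hcont
  have hf' : ∀ β, meanLeaves (fun _ => β) S x T = f β := fun β => congrFun hf β
  simp only [hf'] at *
  obtain ⟨β, hβmem, hβy⟩ : y ∈ f '' Set.uIcc b₁ b₂ := by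
    refine intermediate_value_uIcc (hcont.mono fun β hβ =>
      lt_of_lt_of_le (lt_min hb₁ hb₂) hβ.1) ?_
    rw [Set.mem_uIcc]
    rcases hσ1 with rfl | rfl
    · right; constructor <;> linarith
    · left; constructor <;> linarith
  have hβ : 0 < β := lt_of_lt_of_le (lt_min hb₁ hb₂) hβmem.1
  have hlip1 := abs_le.1 (hlip hb₁ hβ)
  have hlip2 := abs_le.1 (hlip hβ hb₂)
  rw [hβy] at hlip1 hlip2
  have huniq : ∀ β' : ℝ, 0 < β' → f β' = y → β' = β := by
    intro β' hβ' hβ'y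
    rcases lt_trichotomy β' β with hlt | heq | hlt
    · linarith [hanti hβ' hlt]
    · exact heq
    · linarith [hanti hβ hlt]
  -- The Lipschitz bound 2|b-β|T turns an endpoint separation γT into a parameter separation γ/2.
  have hkey : γ / 2 ≤ |b₁ - β| ∧ γ / 2 ≤ |β - b₂| := by
    constructor <;> refine le_of_mul_le_mul_right ?_ hT0 <;>
      rcases hσ1 with rfl | rfl <;> linarith
  refine ⟨β, hβ, hβmem.2.trans (max_le hB₁ hB₂), ?_, ?_, hβy, huniq⟩
  all_goals
    rcases hσ1 with rfl | rfl
    · have h1 : b₁ < b₂ := by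
        by_contra hle
        rcases (not_lt.1 hle).eq_or_lt with rfl | hlt
        · linarith
        · linarith [hanti hb₂ hlt]
      rw [Set.uIcc_of_le h1.le] at hβmem
      rw [abs_of_nonpos (by linarith [hβmem.1]), abs_of_nonpos (by linarith [hβmem.2])] at hkey
      linarith [hkey.1, hkey.2]
    · have h1 : b₂ < b₁ := by
        by_contra hle
        rcases (not_lt.1 hle).eq_or_lt with rfl | hlt
        · linarith
        · linarith [hanti hb₁ hlt]
      rw [Set.uIcc_of_ge h1.le] at hβmem
      rw [abs_of_nonneg (by linarith [hβmem.2]), abs_of_nonneg (by linarith [hβmem.1])] at hkey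
      linarith [hkey.1, hkey.2]

lemma quarter_le {B : ℝ} (hB : 0 < B) (t : ℕ) :
    1 / 4 * ((t : ℝ) + 1) ≤ (1 / 2 - 1 / (4 * (1 + 4 * B))) * ((t : ℝ) + 1) := by
  have : 1 / (4 * (1 + 4 * B)) ≤ 1 / 4 := by
    apply one_div_le_one_div_of_le <;> linarith
  gcongr
  linarith

/-- The gap between the mean and a fitted curve that ends close to the mean has a sharp maximum at
the change point. -/
lemma IsTwoPhase.sharp_max {b : ℕ → ℝ} {S r T : ℕ} {b₁ b₂ x : ℝ}
    (h : IsTwoPhase b S r T b₁ b₂) (hx : 0 ≤ x) (hxS : x ≤ S + 1) (hb₂ : 0 < b₂)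
    {β σ B η ρ κ c₄ c : ℝ} (hβ : 0 < β) (hσ1 : σ = 1 ∨ σ = -1) (hβB : β ≤ B) (hB₁ : b₁ ≤ B)
    (hB₂ : b₂ ≤ B) (hη : 0 ≤ η) (hη1 : η ≤ σ * (β - b₁)) (hη2 : η ≤ σ * (b₂ - β)) (hρ : 0 < ρ)
    (hrS : ρ * T ≤ r - S) (hT0 : (0 : ℝ) < T) (hc₄ : 0 < c₄)
    (hc₄' : c₄ = η / (8 * (1 + B) ^ 2 * (1 + 4 * B))) (hκ : 0 < κ) (hκ1 : κ ≤ ρ / 4)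
    (hκ2 : κ ≤ c₄ * ρ / 8) (hT1 : 4 ≤ ρ * T) (hT2 : 8 ≤ c₄ * ρ * T)
    (hm : ∀ t : ℕ, S ≤ t → κ * T ≤ (t : ℝ) + 1 →
      (1 / 2 - 1 / (4 * (1 + 4 * B))) * ((t : ℝ) + 1) ≤ meanLeaves b S x t)
    (hend : |meanLeaves b S x T - meanLeaves (fun _ => β) S x T| ≤ c₄ * ρ ^ 2 / 4 * T)
    (hc1 : c ≤ c₄) (hc2 : c ≤ c₄ * ρ / 4) {t : ℕ} (hSt : S ≤ t) (htT : t ≤ T) :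
    c * |(t : ℝ) - r| ≤ |meanLeaves b S x r - meanLeaves (fun _ => β) S x r|
      - |meanLeaves b S x t - meanLeaves (fun _ => β) S x t| := by
  have habs : ∀ z : ℝ, |z| = |σ * z| := by
    rcases hσ1 with rfl | rfl <;> simp
  have hB0 : 0 < B := hβ.trans_le hβB
  have hβ1 : 0 ≤ σ * (β - b₁) := hη.trans hη1
  have hS0 : (0 : ℝ) ≤ S := Nat.cast_nonneg S
  have hr : ρ * T ≤ r := by linarith
  have hrT : (r : ℝ) ≤ T := by exact_mod_cast h.le
  have hκT : κ * T ≤ ρ / 4 * T := by gcongr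
  have hmr : ∀ t : ℕ, r ≤ t → t ≤ T → 1 / 4 * ((t : ℝ) + 1) ≤ meanLeaves b S x t := by
    intro t ht _
    have : (r : ℝ) ≤ t := by exact_mod_cast ht
    exact (quarter_le hB0 t).trans (hm t (h.lt.le.trans ht) (by linarith))
  rw [habs (meanLeaves b S x r - _), habs (meanLeaves b S x t - _)]
  have hpos := fun t => h.signed_gap_nonneg hx hβ hβ1 (t := t)
  rw [abs_of_nonneg (hpos r h.lt.le le_rfl)]
  -- the start of the region of linear growth
  have hceil1 : κ * T ≤ ⌈κ * T⌉₊ := Nat.le_ceil _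
  have hceil2 : (⌈κ * T⌉₊ : ℝ) < κ * T + 1 := Nat.ceil_lt_add_one (by positivity)
  obtain ⟨u, hSu, hκu, hmax⟩ : ∃ u : ℕ, S ≤ u ∧ ⌈κ * T⌉₊ ≤ u ∧ (u = S ∨ u = ⌈κ * T⌉₊) := by
    rcases le_total S ⌈κ * T⌉₊ with hle | hle
    · exact ⟨_, hle, le_rfl, Or.inr rfl⟩
    · exact ⟨S, le_rfl, hle, Or.inl rfl⟩
  have hu1 : 1 ≤ u := le_trans (Nat.ceil_pos.2 (by positivity)) hκu
  have hru : ρ / 2 * T ≤ r - u := by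
    rcases hmax with rfl | rfl
    · linarith
    · linarith
  have hur : u ≤ r := by
    have : (u : ℝ) ≤ r := by linarith
    exact_mod_cast this
  have hgrow : ∀ t, u ≤ t → t ≤ r → _ := fun t => h.signed_gap_growth hx hxS hβ hβB hB₁
    hη hη1 hSu hu1 (fun t ht _ => hm t (hSu.trans ht) (by
      have h1 : (⌈κ * T⌉₊ : ℝ) ≤ u := by exact_mod_cast hκu
      have h2 : (u : ℝ) ≤ t := by exact_mod_cast ht
      linarith)) (t := t)
  rw [← hc₄'] at hgrow
  have hru' : c₄ * (ρ / 2 * T) ≤ c₄ * (r - u) := by gcongr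
  have hr4 := hgrow u le_rfl hur
  have hu0 := hpos u hSu hur
  have hSt' : (S : ℝ) ≤ t := by exact_mod_cast hSt
  have htT' : (t : ℝ) ≤ T := by exact_mod_cast htT
  -- As the gap at r is at least c₄ρT/2, any t with |d_t| ≤ c₄ρT/4 is settled by this bound.
  have hdist : c * |(t : ℝ) - r| ≤ c₄ * ρ / 4 * T := by
    refine mul_le_mul hc2 ?_ (abs_nonneg _) (by positivity)
    rw [abs_le]
    constructor <;> linarith
  rcases le_total t r with htr | hrt
  · have htr' : (t : ℝ) ≤ r := by exact_mod_cast htr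
    rw [abs_of_nonneg (hpos t hSt htr)]
    rcases le_or_gt u t with hut | htu
    · rw [abs_of_nonpos (by linarith)]
      have := hgrow t hut htr
      have h2 : c * -(t - r : ℝ) ≤ c₄ * -(t - r : ℝ) :=
        mul_le_mul_of_nonneg_right hc1 (by linarith)
      linarith
    -- Here t < ⌈κT⌉, where the mean has no useful lower bound; the trivial |d_t| ≤ t+1 ≤ κT+1 ≤
    -- c₄ρT/4 suffices.
    · rcases hmax with rfl | rfl
      · omega
      have h1 : σ * (meanLeaves b S x t - meanLeaves (fun _ => β) S x t) ≤ t + 1 := by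
        refine (le_abs_self _).trans ?_
        rw [← habs, abs_le]
        have h1 := meanLeaves_le h.pos hx hxS hSt
        have h2 := meanLeaves_nonneg h.pos S hx t
        have h3 := meanLeaves_le (fun _ => hβ) hx hxS hSt
        have h4 := meanLeaves_nonneg (fun _ => hβ) S hx t
        constructor <;> linarith
      have h2 : (t : ℝ) + 1 ≤ ⌈κ * T⌉₊ := by exact_mod_cast htu
      have h3 : κ * T ≤ c₄ * ρ / 8 * T := by gcongr
      linarith
  · have hrt' : (r : ℝ) ≤ t := by exact_mod_cast hrt
    rcases h.signed_gap_decay hx hb₂ hβ hβB hB₂ hη hη2 hmr hrt htT with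
      ⟨h1, h2⟩ | ⟨h1, h2⟩
    · rw [abs_of_nonneg h1, abs_of_nonneg (by linarith)]
      refine le_trans ?_ h2
      refine mul_le_mul_of_nonneg_right (hc1.trans ?_) (by linarith)
      rw [hc₄']
      refine div_le_div_of_nonneg_left (by positivity) (by positivity) ?_
      exact le_mul_of_one_le_right (by positivity) (by linarith)
    · rw [abs_of_neg h1]
      set d := σ * (meanLeaves b S x t - meanLeaves (fun _ => β) S x t)
      have h3 : -(σ * (meanLeaves b S x T - meanLeaves (fun _ => β) S x T))
          ≤ c₄ * ρ ^ 2 / 4 * T := by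
        rw [habs] at hend
        linarith [(abs_le.1 hend).1]
      have h4 : ρ * T * -d ≤ t * -d := mul_le_mul_of_nonneg_right (hr.trans hrt') (by linarith)
      have h5 : T * (ρ * -d) ≤ T * (c₄ * ρ ^ 2 / 4 * T) := by nlinarith
      have h6 : ρ * -d ≤ c₄ * ρ ^ 2 / 4 * T := le_of_mul_le_mul_left h5 hT0
      have h8 : -d ≤ c₄ * ρ / 4 * T :=
        le_of_mul_le_mul_left (h6.trans (le_of_eq (by ring))) hρ
      linarith

/-- If the final number of leaves is close to its mean, and not too few leaves are present at the
start, then a unique constant parameter fits the final value, and the gap between the mean and the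
fitted curve has a sharp maximum at the change point. -/
theorem exists_fit_of_close {b₁ b₂ ρ : ℝ} (hb₁ : 0 < b₁) (hb₂ : 0 < b₂) (hne : b₁ ≠ b₂)
    (hρ : 0 < ρ) :
    ∃ c : ℝ, 0 < c ∧ ∃ ε : ℝ, 0 < ε ∧ ∃ N : ℕ, ∀ T : ℕ, N ≤ T →
      ∀ (S r : ℕ) (b : ℕ → ℝ) (x y : ℝ), IsTwoPhase b S r T b₁ b₂ →
      ρ * T ≤ T - r → ρ * T ≤ r - S → 0 ≤ x → x ≤ S + 1 → ((S : ℝ) + 1) / 2 - ε * T ≤ x →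
      |y - meanLeaves b S x T| ≤ ε * T →
      ∃ β : ℝ, 0 < β ∧ meanLeaves (fun _ => β) S x T = y ∧
        (∀ β' : ℝ, 0 < β' → meanLeaves (fun _ => β') S x T = y → β' = β) ∧
        ∀ t : ℕ, S ≤ t → t ≤ T → c * |(t : ℝ) - r| ≤
          |meanLeaves b S x r - meanLeaves (fun _ => β) S x r|
            - |meanLeaves b S x t - meanLeaves (fun _ => β) S x t| := by
  obtain ⟨σ, hσ1, hσ⟩ : ∃ σ : ℝ, (σ = 1 ∨ σ = -1) ∧ 0 < σ * (b₂ - b₁) := by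
    rcases lt_or_gt_of_ne hne with h | h
    · exact ⟨1, Or.inl rfl, by linarith⟩
    · exact ⟨-1, Or.inr rfl, by linarith⟩
  have habs : ∀ z : ℝ, |z| = |σ * z| := by
    rcases hσ1 with rfl | rfl <;> simp
  obtain ⟨B, hB₁, hB₂⟩ : ∃ B : ℝ, b₁ ≤ B ∧ b₂ ≤ B :=
    ⟨max b₁ b₂, le_max_left _ _, le_max_right _ _⟩
  have hB0 : 0 < B := hb₁.trans_le hB₁
  -- The factor ρ²/8 is (ρ/2)(ρ/4), the price of starting at the midpoint of S and r in `hhigh`.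
  obtain ⟨c₀, hc₀, hc₀'⟩ : ∃ c₀ : ℝ, 0 < c₀ ∧
      c₀ = 1 / 4 * (σ * (b₂ - b₁) / (2 * (1 + B) ^ 2)) * (ρ ^ 2 / 8) :=
    ⟨_, by positivity, rfl⟩
  -- The growth rate before the change for η = c₀/4, the distance of β from b₁ and b₂.
  obtain ⟨c₄, hc₄, hc₄'⟩ : ∃ c₄ : ℝ, 0 < c₄ ∧
      c₄ = c₀ / 4 / (8 * (1 + B) ^ 2 * (1 + 4 * B)) := ⟨_, by positivity, rfl⟩
  obtain ⟨κ, hκ, hκ1, hκ2⟩ : ∃ κ : ℝ, 0 < κ ∧ κ ≤ ρ / 4 ∧ κ ≤ c₄ * ρ / 8 :=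
    ⟨min (ρ / 4) (c₄ * ρ / 8), by positivity, min_le_left _ _, min_le_right _ _⟩
  -- The three bounds serve, in order, to keep y between the extreme fits, to keep the mean near
  -- (t+1)/2 once t+1 ≥ κT, and to make the final gap small.
  obtain ⟨ε, hε, hε1, hε2, hε3⟩ : ∃ ε : ℝ, 0 < ε ∧ ε ≤ c₀ / 2 ∧ ε ≤ κ * (1 / (4 * (1 + 4 * B))) ∧
      ε ≤ c₄ * ρ ^ 2 / 4 :=
    ⟨min (c₀ / 2) (min (κ * (1 / (4 * (1 + 4 * B)))) (c₄ * ρ ^ 2 / 4)), by positivity,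
      min_le_left _ _, (min_le_right _ _).trans (min_le_left _ _),
      (min_le_right _ _).trans (min_le_right _ _)⟩
  obtain ⟨c, hc, hc1, hc2⟩ : ∃ c : ℝ, 0 < c ∧ c ≤ c₄ ∧ c ≤ c₄ * ρ / 4 :=
    ⟨min c₄ (c₄ * ρ / 4), by positivity, min_le_left _ _, min_le_right _ _⟩
  obtain ⟨N, hN⟩ := exists_nat_ge (max (4 / ρ) (8 / (c₄ * ρ)))
  refine ⟨c, hc, ε, hε, N, fun T hNT S r b x y h hTr hrS hx hxS hxS' hy => ?_⟩
  have hNT' : (N : ℝ) ≤ T := by exact_mod_cast hNT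
  have hT1 : 4 ≤ ρ * T := by
    have := (le_max_left _ _).trans (hN.trans hNT')
    rwa [div_le_iff₀' hρ] at this
  have hT2 : 8 ≤ c₄ * ρ * T := by
    have := (le_max_right _ _).trans (hN.trans hNT')
    rwa [div_le_iff₀' (by positivity)] at this
  have hT0 : (0 : ℝ) < T := by
    by_contra hle
    have : (T : ℝ) ≤ 0 := not_lt.1 hle
    nlinarith
  have hS0 : (0 : ℝ) ≤ S := Nat.cast_nonneg S
  have hr : ρ * T ≤ r := by linarith
  have hrT : (r : ℝ) ≤ T := by exact_mod_cast h.le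
  -- lower bounds for the mean
  have hm : ∀ t : ℕ, S ≤ t → κ * T ≤ (t : ℝ) + 1 →
      (1 / 2 - 1 / (4 * (1 + 4 * B))) * ((t : ℝ) + 1) ≤ meanLeaves b S x t := by
    intro t hSt ht
    have h1 := le_meanLeaves h.pos hx (by positivity) hxS' hSt
    have h2 : ε * T ≤ 1 / (4 * (1 + 4 * B)) * (t + 1) := by
      calc ε * T ≤ κ * (1 / (4 * (1 + 4 * B))) * T := by gcongr
        _ = 1 / (4 * (1 + 4 * B)) * (κ * T) := by ring
        _ ≤ _ := by gcongr
    linarith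
  have hm' : ∀ t : ℕ, S ≤ t → κ * T ≤ (t : ℝ) + 1 →
      1 / 4 * ((t : ℝ) + 1) ≤ meanLeaves b S x t := by
    exact fun t hSt ht => (quarter_le hB0 t).trans (hm t hSt ht)
  have hκT : κ * T ≤ ρ / 4 * T := by gcongr
  have hmr : ∀ t : ℕ, r ≤ t → t ≤ T → 1 / 4 * ((t : ℝ) + 1) ≤ meanLeaves b S x t := by
    intro t ht _
    have : (r : ℝ) ≤ t := by exact_mod_cast ht
    exact hm' t (h.lt.le.trans ht) (by linarith)
  -- the fitted curves with parameters `b₁` and `b₂` end far from the mean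
  have hlow : c₀ * T ≤ σ * (meanLeaves (fun _ => b₁) S x T - meanLeaves b S x T) := by
    have h1 := h.fit_first_sub_ge hb₂ hB₁ hB₂ hσ.le hmr
    set C := 1 / 4 * (σ * (b₂ - b₁) / (2 * (1 + B) ^ 2)) with hC
    have hC0 : 0 < C := by positivity
    have h2 : C * (ρ * T) * (ρ * T) ≤ C * (T - r) * r := by gcongr
    have h3 : T * (c₀ * T) ≤ C * (ρ * T) * (ρ * T) := by
      rw [hc₀']
      have : 0 ≤ C * ρ ^ 2 * T ^ 2 := by positivity
      nlinarith
    exact le_of_mul_le_mul_left (h3.trans (h2.trans h1)) hT0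
  -- Growth counted from S would carry a factor S, useless when S is small; hence the midpoint.
  have hhigh : c₀ * T ≤ σ * (meanLeaves b S x T - meanLeaves (fun _ => b₂) S x T) := by
    have hu1 : ((S : ℝ) + r) / 2 - 1 / 2 ≤ ((S + r) / 2 : ℕ) := by
      have : S + r ≤ 2 * ((S + r) / 2) + 1 := by omega
      have : (S : ℝ) + r ≤ 2 * ((S + r) / 2 : ℕ) + 1 := by exact_mod_cast this
      linarith
    have hu2 : (((S + r) / 2 : ℕ) : ℝ) ≤ ((S : ℝ) + r) / 2 := by
      have : 2 * ((S + r) / 2) ≤ S + r := by omega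
      have : 2 * (((S + r) / 2 : ℕ) : ℝ) ≤ (S : ℝ) + r := by exact_mod_cast this
      linarith
    have hlt := h.lt
    have hSu : S ≤ (S + r) / 2 := by omega
    have hur : (S + r) / 2 ≤ r := by omega
    set u := (S + r) / 2
    have hu3 : ρ / 4 * T ≤ u := by linarith
    have hu4 : 1 ≤ u := by
      have : (1 : ℝ) ≤ u := by linarith
      exact_mod_cast this
    have h1 := h.sub_fit_second_ge hx hb₂ hB₁ hB₂ hσ.le hSu hu4 hur fun t ht _ => by
      have : (u : ℝ) ≤ t := by exact_mod_cast ht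
      exact hm' t (hSu.trans ht) (by linarith)
    set C := 1 / 4 * (σ * (b₂ - b₁) / (2 * (1 + B) ^ 2)) with hC
    have hC0 : 0 < C := by positivity
    have hu5 : ρ / 2 * T ≤ r - u := by linarith
    have h2 : C * (ρ / 2 * T) * (ρ / 4 * T) ≤ C * (r - u) * u := by
      have : 0 ≤ (r : ℝ) - u := le_trans (by positivity) hu5
      gcongr
    have h3 : T * (c₀ * T) ≤ C * (ρ / 2 * T) * (ρ / 4 * T) := by
      rw [hc₀']
      exact le_of_eq (by ring)
    exact le_of_mul_le_mul_left (h3.trans (h2.trans h1)) hT0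
  have hεT : ε * T ≤ c₀ / 2 * T := by gcongr
  have hyσ : |σ * (y - meanLeaves b S x T)| ≤ ε * T := by rwa [← habs]
  have hy1 : c₀ / 2 * T ≤ σ * (meanLeaves (fun _ => b₁) S x T - y) := by
    have := (abs_le.1 hyσ).2
    linarith
  have hy2 : c₀ / 2 * T ≤ σ * (y - meanLeaves (fun _ => b₂) S x T) := by
    have := (abs_le.1 hyσ).1
    linarith
  have hST : S + 2 ≤ T := by
    have : (S : ℝ) + 2 ≤ T := by linarith
    exact_mod_cast this
  obtain ⟨β, hβ, hβB, hη1, hη2, hβy, huniq⟩ :=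
    exists_fit_between hST hx hxS hb₁ hb₂ hB₁ hB₂ hσ1 (half_pos hc₀) hy1 hy2
  rw [show c₀ / 2 / 2 = c₀ / 4 by ring] at hη1 hη2
  refine ⟨β, hβ, hβy, huniq, fun t hSt htT => ?_⟩
  refine h.sharp_max hx hxS hb₂ hβ hσ1 hβB hB₁ hB₂ (by positivity) hη1 hη2 hρ hrS hT0
    hc₄ hc₄' hκ hκ1 hκ2 hT1 hT2 hm ?_ hc1 hc2 hSt htT
  rw [hβy, abs_sub_comm]
  exact hy.trans (mul_le_mul_of_nonneg_right hε3 hT0.le)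

/-! ### Concentration and passage to the limit -/

/-- The event that the final number of leaves is close to its conditional mean, and that about half
of the vertices at least are leaves at time `S`. -/
def concentrated (a : ℕ → ℝ) (S T : ℕ) (ε : ℝ) : Set (History T) :=
  {ω | |(leaves ω T : ℝ) - meanLeaves (fun s => 1 + a s) S (leaves ω S) T| ≤ ε * T ∧
    ((S : ℝ) + 1) / 2 - ε * T ≤ leaves ω S}

lemma law_compl_concentrated_le {a : ℕ → ℝ} (ha : ∀ t, -1 < a t) {S T : ℕ} (hST : S ≤ T)
    (hT : 0 < T) {ε : ℝ} (hε : 0 < ε) :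
    law T a (concentrated a S T ε)ᶜ ≤ ENNReal.ofReal (2 / ε ^ 2 / T) := by
  have hT' : (0 : ℝ) < T := by exact_mod_cast hT
  have hδ : 0 < ε * T := by positivity
  have h1 := law_lt_abs_le ha hδ (expect_sq_sub_le (T := T) ha S hST le_rfl)
  have h2 := law_lt_abs_le ha hδ (expect_sq_sub_le (T := T) ha 0 S.zero_le hST)
  have hsub : (concentrated a S T ε)ᶜ ⊆
      {ω | ε * T < |(leaves ω T : ℝ) - meanLeaves (fun s => 1 + a s) S (leaves ω S) T|} ∪
      {ω | ε * T < |(leaves ω S : ℝ) - meanLeaves (fun s => 1 + a s) 0 (leaves ω 0) S|} := by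
    intro ω hω
    by_contra hcon
    simp only [Set.mem_union, Set.mem_ofPred_eq, not_or, not_lt] at hcon
    refine hω ⟨hcon.1, ?_⟩
    have h3 := le_meanLeaves (b := fun s => 1 + a s) (fun s => by linarith [ha s]) (S := 0)
      (x := leaves ω 0) (e := 0) (Nat.cast_nonneg _) le_rfl (by simp [leaves_zero]; norm_num)
      S.zero_le
    have h4 := (abs_le.1 hcon.2).1
    linarith
  refine (measure_mono hsub).trans ((measure_union_le _ _).trans ((add_le_add h1 h2).trans ?_))
  have hST' : (S : ℝ) ≤ T := by exact_mod_cast hST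
  have hS0 : (0 : ℝ) ≤ S := Nat.cast_nonneg S
  rw [← ENNReal.ofReal_add (div_nonneg (by linarith) (by positivity))
    (div_nonneg (by simp) (by positivity))]
  refine ENNReal.ofReal_le_ofReal ?_
  rw [← add_div, div_div, div_le_div_iff₀ (by positivity) (by positivity)]
  push_cast
  have : 0 ≤ ε ^ 2 * T ^ 2 := by positivity
  nlinarith

lemma tendsto_law_of_concentrated {a : ℕ → ℕ → ℝ} (ha : ∀ T t, -1 < a T t) {S : ℕ → ℕ}
    (hS : ∀ᶠ T in atTop, S T ≤ T) {ε : ℝ} (hε : 0 < ε) {A : (T : ℕ) → Set (History T)}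
    (hA : ∀ᶠ T in atTop, concentrated (a T) (S T) T ε ⊆ A T) :
    Tendsto (fun T => law T (a T) (A T)) atTop (𝓝 1) := by
  have hlim : Tendsto (fun T : ℕ => 1 - ENNReal.ofReal (2 / ε ^ 2 / T)) atTop (𝓝 1) := by
    have h1 : Tendsto (fun T : ℕ => 2 / ε ^ 2 / (T : ℝ)) atTop (𝓝 0) :=
      tendsto_const_div_atTop_nhds_zero_nat _
    have h2 := ENNReal.tendsto_ofReal h1
    rw [ENNReal.ofReal_zero] at h2
    simpa using ENNReal.Tendsto.sub (tendsto_const_nhds (x := (1 : ENNReal))) h2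
      (Or.inl ENNReal.one_ne_top)
  refine tendsto_of_tendsto_of_tendsto_of_le_of_le' hlim tendsto_const_nhds ?_ ?_
  · filter_upwards [hS, hA, eventually_gt_atTop 0] with T hST hAT hT
    have := isProbabilityMeasure_law (T := T) (ha T)
    refine le_trans ?_ (measure_mono hAT)
    rw [tsub_le_iff_right, ← prob_add_prob_compl (μ := law T (a T))
      (MeasurableSet.of_discrete (s := concentrated (a T) (S T) T ε))]
    gcongr
    exact law_compl_concentrated_le (ha T) hST hT hε
  · filter_upwards with T
    have := isProbabilityMeasure_law (T := T) (ha T)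
    exact prob_le_one

/-- An exact fit makes the minimum zero, so the minimizers are precisely the exact fits. -/
lemma isAHat_iff {a : ℕ → ℝ} (ha : ∀ t, -1 < a t) {S T : ℕ} (hST : S ≤ T) {ω : History T}
    {β : ℝ} (hβ : 0 < β) (hfit : meanLeaves (fun _ => β) S (leaves ω S) T = leaves ω T)
    (huniq : ∀ β' : ℝ, 0 < β' → meanLeaves (fun _ => β') S (leaves ω S) T = leaves ω T → β' = β)
    (α : ℝ) : IsAHat a S ω α ↔ α = β - 1 := by
  have h0 : fitted a S T (β - 1) ω = leaves ω T := by
    rw [fitted_eq ha hST le_rfl (by linarith), add_sub_cancel, hfit]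
  constructor
  · rintro ⟨hα, hmin⟩
    have h1 := hmin (β - 1) (by linarith)
    rw [h0, sub_self, zero_pow two_ne_zero] at h1
    have h2 := sub_eq_zero.1 (pow_eq_zero_iff two_ne_zero |>.1 (le_antisymm h1 (sq_nonneg _)))
    rw [fitted_eq ha hST le_rfl hα] at h2
    linarith [huniq (1 + α) (by linarith) h2]
  · rintro rfl
    refine ⟨by linarith, fun γ _ => ?_⟩
    rw [h0, sub_self, zero_pow two_ne_zero]
    exact sq_nonneg _

lemma gap_eq {a : ℕ → ℝ} (ha : ∀ t, -1 < a t) {S T : ℕ} {β : ℝ} (hβ : 0 < β) (ω : History T)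
    {t : ℕ} (hSt : S ≤ t) (htT : t ≤ T) :
    gap a S (β - 1) ω t = |meanLeaves (fun s => 1 + a s) S (leaves ω S) t
      - meanLeaves (fun _ => β) S (leaves ω S) t| := by
  unfold gap
  rw [condMean_eq ha hSt htT, fitted_eq ha hSt htT (by linarith), add_sub_cancel]

/-- With high probability the estimator exists, is unique, and the gap has a sharp maximum at the
last time before the change. -/
lemma eventually_sharp_max {α₁ α₂ : ℝ} (hα₁ : -1 < α₁) (hα₂ : -1 < α₂) (hne : α₁ ≠ α₂)
    {S R : ℕ → ℕ} (hSRT : ∀ᶠ T : ℕ in atTop, S T < R T ∧ R T < T)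
    {a : ℕ → ℕ → ℝ} (ha : ∀ T t : ℕ, -1 < a T t)
    (ha₁ : ∀ T t : ℕ, S T ≤ t → t < R T → a T t = α₁)
    (ha₂ : ∀ T t : ℕ, R T ≤ t → t ≤ T → a T t = α₂)
    {ρ₁ ρ₂ : ℝ} (hρ₁ : 0 < ρ₁) (hρ₂ : 0 < ρ₂)
    (hlim₁ : Tendsto (fun T : ℕ => ((T : ℝ) - (R T : ℝ)) / (T : ℝ)) atTop (𝓝 ρ₁))
    (hlim₂ : Tendsto (fun T : ℕ => ((R T : ℝ) - (S T : ℝ)) / (T : ℝ)) atTop (𝓝 ρ₂)) :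
    ∃ c : ℝ, 0 < c ∧ ∃ ε : ℝ, 0 < ε ∧ ∀ᶠ T : ℕ in atTop, ∀ ω ∈ concentrated (a T) (S T) T ε,
      ∃ α : ℝ, (∀ β : ℝ, IsAHat (a T) (S T) ω β ↔ β = α) ∧ ∃ r : ℕ, r + 1 = R T ∧
        r ∈ Set.Ioo (S T) T ∧ ∀ t : ℕ, S T ≤ t → t ≤ T →
          c * |(t : ℝ) - (r : ℝ)| ≤ gap (a T) (S T) α ω r - gap (a T) (S T) α ω t := by
  -- Halving absorbs the limits; the second halving pays for r-S = R-S-1.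
  have hρ : 0 < min (ρ₁ / 2) (ρ₂ / 4) := by positivity
  obtain ⟨c, hc, ε, hε, N, H⟩ := exists_fit_of_close (b₁ := 1 + α₁) (b₂ := 1 + α₂)
    (by linarith) (by linarith) (fun h => hne (by linarith)) hρ
  refine ⟨c, hc, ε, hε, ?_⟩
  filter_upwards [hSRT, eventually_ge_atTop N, eventually_gt_atTop 0,
    eventually_ge_atTop ⌈8 / ρ₂⌉₊, hlim₁.eventually_const_lt (half_lt_self hρ₁),
    hlim₂.eventually_const_lt (half_lt_self hρ₂)] with T hT hN hT0 hT8 h1 h2 ω hω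
  have hT0' : (0 : ℝ) < T := by exact_mod_cast hT0
  rw [lt_div_iff₀ hT0'] at h1 h2
  have h8 : 8 ≤ ρ₂ * T := by
    have := (Nat.le_ceil (8 / ρ₂)).trans (show (⌈8 / ρ₂⌉₊ : ℝ) ≤ T by exact_mod_cast hT8)
    rwa [div_le_iff₀' hρ₂] at this
  -- G_{R-1} is the last graph grown with α₁, since a_R already equals α₂.
  obtain ⟨r, hr⟩ : ∃ r, R T = r + 1 := ⟨R T - 1, by omega⟩
  have hr' : (R T : ℝ) = r + 1 := by exact_mod_cast hr
  rw [hr'] at h1 h2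
  have hm1 := mul_le_mul_of_nonneg_right (min_le_left (ρ₁ / 2) (ρ₂ / 4)) hT0'.le
  have hm2 := mul_le_mul_of_nonneg_right (min_le_right (ρ₁ / 2) (ρ₂ / 4)) hT0'.le
  have hSr : S T < r := by
    have : (S T : ℝ) < r := by linarith
    exact_mod_cast this
  have hphase : IsTwoPhase (fun s => 1 + a T s) (S T) r T (1 + α₁) (1 + α₂) :=
    { pos := fun t => by linarith [ha T t]
      lt := hSr
      le := by omega
      first := fun t h h' => by rw [ha₁ T t h.le (by omega)]
      second := fun t h h' => by rw [ha₂ T t (by omega) h'] }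
  obtain ⟨β, hβ, hfit, huniq, hmax⟩ := H T hN (S T) r _ (leaves ω (S T)) (leaves ω T) hphase
    (by linarith) (by linarith) (Nat.cast_nonneg _) (by exact_mod_cast leaves_le ω (S T))
    hω.2 hω.1
  have hST : S T ≤ T := by omega
  refine ⟨β - 1, isAHat_iff (ha T) hST hβ hfit huniq, r, hr.symm, ⟨hSr, by omega⟩,
    fun t hSt htT => ?_⟩
  rw [gap_eq (ha T) hβ ω hSt htT, gap_eq (ha T) hβ ω hSr.le (by omega)]
  exact hmax t hSt htT

lemma isRHat_iff_of_sharp_max {h : ℕ → ℝ} {S T r : ℕ} {c : ℝ} (hc : 0 < c)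
    (hr : r ∈ Set.Ioo S T)
    (hmax : ∀ t : ℕ, S ≤ t → t ≤ T → c * |(t : ℝ) - (r : ℝ)| ≤ h r - h t) (s : ℕ) :
    IsRHat h S T s ↔ s = r := by
  constructor
  · rintro ⟨hs, hs'⟩
    by_contra hne
    have h1 := hmax s hs.1.le hs.2.le
    have h2 : 0 < |(s : ℝ) - r| := abs_pos.2 (sub_ne_zero.2 (by exact_mod_cast hne))
    have h3 := mul_pos hc h2
    linarith [hs' r hr]
  · rintro rfl
    refine ⟨hr, fun t ht => ?_⟩
    have h1 := hmax t ht.1.le ht.2.le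
    have h2 : 0 ≤ c * |(t : ℝ) - s| := by positivity
    linarith

end PrefAttach

end

theorem proposition3p2
    (α₁ α₂ : ℝ) (hα₁ : -1 < α₁) (hα₂ : -1 < α₂) (hne : α₁ ≠ α₂)
    (S R : ℕ → ℕ) (hSRT : ∀ᶠ T : ℕ in atTop, S T < R T ∧ R T < T)
    (a : ℕ → ℕ → ℝ) (ha : ∀ T t : ℕ, -1 < a T t)
    (ha₁ : ∀ T t : ℕ, S T ≤ t → t < R T → a T t = α₁)
    (ha₂ : ∀ T t : ℕ, R T ≤ t → t ≤ T → a T t = α₂)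
    (ρ₁ ρ₂ : ℝ) (hρ₁ : 0 < ρ₁) (hρ₂ : 0 < ρ₂)
    (hlim₁ : Tendsto (fun T : ℕ => ((T : ℝ) - (R T : ℝ)) / (T : ℝ)) atTop (𝓝 ρ₁))
    (hlim₂ : Tendsto (fun T : ℕ => ((R T : ℝ) - (S T : ℝ)) / (T : ℝ)) atTop (𝓝 ρ₂)) :
    Tendsto
      (fun T : ℕ => PrefAttach.law T (a T)
        {ω | ∃ α : ℝ, (∀ β : ℝ, PrefAttach.IsAHat (a T) (S T) ω β ↔ β = α) ∧
          ∀ r : ℕ, PrefAttach.IsRHat (PrefAttach.gap (a T) (S T) α ω) (S T) T r ↔ r + 1 = R T})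
      atTop (𝓝 1) ∧
    ∃ c : ℝ, 0 < c ∧
      Tendsto
        (fun T : ℕ => PrefAttach.law T (a T)
          {ω | ∃ α : ℝ, (∀ β : ℝ, PrefAttach.IsAHat (a T) (S T) ω β ↔ β = α) ∧
            ∃ r : ℕ, PrefAttach.IsRHat (PrefAttach.gap (a T) (S T) α ω) (S T) T r ∧
              ∀ t : ℕ, S T ≤ t → t ≤ T →
                c * |(t : ℝ) - (r : ℝ)| ≤
                  PrefAttach.gap (a T) (S T) α ω r - PrefAttach.gap (a T) (S T) α ω t})
        atTop (𝓝 1) := by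
  obtain ⟨c, hc, ε, hε, H⟩ := PrefAttach.eventually_sharp_max hα₁ hα₂ hne hSRT ha ha₁ ha₂
    hρ₁ hρ₂ hlim₁ hlim₂
  have hS : ∀ᶠ T in atTop, S T ≤ T := hSRT.mono fun T hT => (hT.1.trans hT.2).le
  refine ⟨PrefAttach.tendsto_law_of_concentrated ha hS hε ?_, c, hc,
    PrefAttach.tendsto_law_of_concentrated ha hS hε ?_⟩
  · filter_upwards [H] with T hT ω hω
    obtain ⟨α, hα, r, hrR, hr, hmax⟩ := hT ω hω
    refine ⟨α, hα, fun s => ?_⟩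
    rw [PrefAttach.isRHat_iff_of_sharp_max hc hr hmax s]
    omega
  · filter_upwards [H] with T hT ω hω
    obtain ⟨α, hα, r, -, hr, hmax⟩ := hT ω hω
    exact ⟨α, hα, r, (PrefAttach.isRHat_iff_of_sharp_max hc hr hmax r).2 rfl, hmax⟩
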